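/- Let $\Lambda\subset\mathbb C$ be a lattice, $E=\mathbb C/\Lambda$ the corresponding complex elliptic curve, $P\in E$ its origin, and $dz$ the standard holomorphic differential on $E$. Let $f$ be a non-constant meromorphic function on $E$, regarded as a finite cover $f:E\to\mathbb P^1$ with branch locus $B$. We call $f$ an *odd cover* if its monodromy group (the image of $\pi_1(\mathbb P^1\setminus B)\to S_{\deg f}$) is contained in the alternating group and its local monodromy around each branch point is a product of disjoint cycles of odd length. We say that $f$ has *associated spin structure* $\vartheta\in\mathrm{Pic}(E)$ if the ramification divisor $R_f=\sum_x(e_x-1)x$ is of the form $R_f=2D$ for a divisor $D$, and $\vartheta\cong\mathcal O_E(D)\otimes f^*\mathcal O_{\mathbb P^1}(-1)$. Let $\vartheta\in\mathrm{Pic}^0(E)[2]$. 1. If $\vartheta\cong\mathcal O_E$, then $f$ is an odd cover with associated spin structure $\vartheta$ if and only if there exists a meromorphic function $s$ on $E$ with $df=s^2\,dz$. 2. If $\vartheta\cong\mathcal O_E(P-Q)$, where $Q\in E$ is a point of order two, and $h$ is a meromorphic function on $E$ with divisor $\mathrm{div}(h)=2Q-2P$, then $f$ is an odd cover with associated spin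 structure $\vartheta$ if and only if there exists a meromorphic function $s$ on $E$ with $df=s^2h\,dz$. -/

import Mathlib

open Filter Topology
open scoped OnePoint

noncomputable section

namespace OddCover

/-- The complex elliptic curve `E = ℂ / Λ`, where `Λ` is the lattice spanned by a pair of periods.
Its origin `0` is the image of `0 ∈ ℂ`. -/
abbrev EllipticCurve (L : PeriodPair) : Type := ℂ ⧸ L.lattice.toAddSubgroup

/-- A meromorphic function on `E = ℂ / Λ`, given as a `Λ`-periodic meromorphic function on `ℂ`.
As always in Mathlib the values on a discrete set (in particular at the poles) carry no information;
every notion below depends only on the germs of the function on punctured neighbourhoods. -/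
structure MeromorphicFunction (L : PeriodPair) where
  toFun : ℂ → ℂ
  meromorphic' : Meromorphic toFun
  periodic' : ∀ l ∈ L.lattice, ∀ z, toFun (z + l) = toFun z

variable {L : PeriodPair}

instance : CoeFun (MeromorphicFunction L) (fun _ => ℂ → ℂ) := ⟨MeromorphicFunction.toFun⟩

/-- A quantity attached to the points of `ℂ` that is `Λ`-periodic, seen on `E`. -/
def descend {α : Type*} (F : ℂ → α) (hF : ∀ l ∈ L.lattice, ∀ z, F (z + l) = F z) :
    EllipticCurve L → α :=
  Quotient.lift F (by
    intro a b hab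
    have h : -a + b ∈ L.lattice := QuotientAddGroup.leftRel_apply.mp hab
    have := hF _ h a
    rw [← this]
    congr 1
    ring)

/-- The order of vanishing of a meromorphic function at a point; negative at poles. -/
def pointOrder (f : ℂ → ℂ) (z : ℂ) : WithTop ℤ := meromorphicOrderAt f z

/-- The value in `ℙ¹(ℂ) = ℂ ∪ {∞}` of a meromorphic function at a point:
`∞` at a pole, and the limit of the function at any other point. -/
def pointValue (f : ℂ → ℂ) (z : ℂ) : OnePoint ℂ :=
  open scoped Classical in
  if meromorphicOrderAt f z < 0 then ∞ else ((limUnder (𝓝[≠] z) f : ℂ) : OnePoint ℂ)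

/-- The ramification index at `z` of a non-constant meromorphic function seen as a map to `ℙ¹(ℂ)`:
the pole order at a pole, and the order of vanishing of `f - f(z)` at any other point. -/
def pointIndex (f : ℂ → ℂ) (z : ℂ) : ℤ :=
  open scoped Classical in
  if meromorphicOrderAt f z < 0 then -(meromorphicOrderAt f z).untop₀
  else (meromorphicOrderAt (fun w => f w - limUnder (𝓝[≠] z) f) z).untop₀

lemma pointOrder_add (f : ℂ → ℂ) (l z : ℂ) (hf : ∀ w, f (w + l) = f w) :
    pointOrder f (z + l) = pointOrder f z := by
  have h := meromorphicOrderAt_comp_add_const_eq_meromorphicOrderAt (f := f) (x := z) (c := l)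
  have h2 : (f ∘ fun w => w + l) = f := funext hf
  unfold pointOrder
  rw [← h]
  exact congrArg (fun g => meromorphicOrderAt g z) h2

lemma limUnder_add (f : ℂ → ℂ) (l z : ℂ) (hf : ∀ w, f (w + l) = f w) :
    limUnder (𝓝[≠] (z + l)) f = limUnder (𝓝[≠] z) f := by
  have h : Filter.map (fun w => w + l) (𝓝[≠] z) = 𝓝[≠] (z + l) := by
    simp
  have h2 : (f ∘ fun w => w + l) = f := funext hf
  unfold limUnder
  rw [← h, Filter.map_map, h2]

lemma pointValue_add (f : ℂ → ℂ) (l z : ℂ) (hf : ∀ w, f (w + l) = f w) :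
    pointValue f (z + l) = pointValue f z := by
  have h := pointOrder_add f l z hf
  unfold pointOrder at h
  unfold pointValue
  rw [h, limUnder_add f l z hf]

lemma pointIndex_add (f : ℂ → ℂ) (l z : ℂ) (hf : ∀ w, f (w + l) = f w) :
    pointIndex f (z + l) = pointIndex f z := by
  have h := pointOrder_add f l z hf
  have h' := pointOrder_add (fun w => f w - limUnder (𝓝[≠] z) f) l z (by intro w; simp [hf])
  unfold pointOrder at h h'
  unfold pointIndex
  rw [h, limUnder_add f l z hf, h']

namespace MeromorphicFunction

/-- The order of a meromorphic function at a point of `E`. -/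
def ord (f : MeromorphicFunction L) : EllipticCurve L → WithTop ℤ :=
  descend (pointOrder f) fun l hl z => pointOrder_add f l z (f.periodic' l hl)

/-- The map `f : E → ℙ¹(ℂ)` given by a meromorphic function. -/
def toSphere (f : MeromorphicFunction L) : EllipticCurve L → OnePoint ℂ :=
  descend (pointValue f) fun l hl z => pointValue_add f l z (f.periodic' l hl)

/-- The ramification index `e_x` of `f : E → ℙ¹(ℂ)` at `x ∈ E` (for `f` non-constant). -/
def ramificationIndex (f : MeromorphicFunction L) : EllipticCurve L → ℤ :=
  descend (pointIndex f) fun l hl z => pointIndex_add f l z (f.periodic' l hl)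

/-- `f` is constant as a meromorphic function, i.e. up to its values on a discrete set. -/
def IsConstant (f : MeromorphicFunction L) : Prop :=
  ∃ c : ℂ, f =ᶠ[codiscrete ℂ] fun _ => c

/-- The constant function `1`. -/
def one (L : PeriodPair) : MeromorphicFunction L where
  toFun := fun _ => 1
  meromorphic' := fun z => MeromorphicAt.const 1 z
  periodic' := fun _ _ _ => rfl

/-- The product of two meromorphic functions. -/
def mul (f g : MeromorphicFunction L) : MeromorphicFunction L where
  toFun := f.toFun * g.toFun
  meromorphic' := fun z => (f.meromorphic' z).mul (g.meromorphic' z)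
  periodic' := fun l hl z => by simp [f.periodic' l hl, g.periodic' l hl]

/-- The inverse of a meromorphic function. -/
def inv (f : MeromorphicFunction L) : MeromorphicFunction L where
  toFun := (f.toFun)⁻¹
  meromorphic' := fun z => (f.meromorphic' z).inv
  periodic' := fun l hl z => by simp [f.periodic' l hl]

lemma ord_one (x : EllipticCurve L) : (one L).ord x = 0 := by
  classical
  induction x using Quotient.inductionOn with
  | _ z => exact (meromorphicOrderAt_const z (1 : ℂ)).trans (by simp)

lemma ord_mul (f g : MeromorphicFunction L) (x : EllipticCurve L) :
    (f.mul g).ord x = f.ord x + g.ord x := by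
  induction x using Quotient.inductionOn with
  | _ z => exact meromorphicOrderAt_mul (f.meromorphic' z) (g.meromorphic' z)

lemma ord_inv (f : MeromorphicFunction L) (x : EllipticCurve L) :
    f.inv.ord x = -f.ord x := by
  induction x using Quotient.inductionOn with
  | _ z => exact meromorphicOrderAt_inv

end MeromorphicFunction

/-! ### Divisors and the Picard group -/

/-- Divisors on `E`: finite formal `ℤ`-linear combinations of points. -/
abbrev Divisor (L : PeriodPair) : Type := EllipticCurve L →₀ ℤ

/-- The degree of a divisor. -/
def degree (L : PeriodPair) : Divisor L →+ ℤ :=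
  Finsupp.liftAddHom fun _ => AddMonoidHom.id ℤ

/-- The point `x`, as a divisor. -/
def point (x : EllipticCurve L) : Divisor L := Finsupp.single x 1

/-- `div g = D`. As `D` takes finite values, this contains that `g` is not identically zero. -/
def IsDivisorOf (g : MeromorphicFunction L) (D : Divisor L) : Prop :=
  ∀ x, g.ord x = (D x : WithTop ℤ)

/-- The group of principal divisors `div g`. -/
def principalDivisors (L : PeriodPair) : AddSubgroup (Divisor L) where
  carrier := {D | ∃ g : MeromorphicFunction L, IsDivisorOf g D}
  zero_mem' := ⟨MeromorphicFunction.one L, fun x => by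
    rw [MeromorphicFunction.ord_one]; rfl⟩
  add_mem' := by
    rintro D D' ⟨g, hg⟩ ⟨g', hg'⟩
    exact ⟨g.mul g', fun x => by
      rw [MeromorphicFunction.ord_mul, hg x, hg' x, Finsupp.add_apply]; rfl⟩
  neg_mem' := by
    rintro D ⟨g, hg⟩
    exact ⟨g.inv, fun x => by
      rw [MeromorphicFunction.ord_inv, hg x, Finsupp.neg_apply]; rfl⟩

/-- The Picard group `Pic E`, as the group of divisors modulo principal divisors. -/
abbrev Pic (L : PeriodPair) : Type := Divisor L ⧸ principalDivisors L

/-- The class in `Pic E` of the line bundle `𝒪_E(D)`. -/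
def lineBundle (D : Divisor L) : Pic L := QuotientAddGroup.mk D

/-- `Pic⁰ E`, the classes of divisors of degree `0`. -/
def picZero (L : PeriodPair) : AddSubgroup (Pic L) :=
  (degree L).ker.map (QuotientAddGroup.mk' (principalDivisors L))

/-! ### Monodromy and odd covers -/

namespace MeromorphicFunction

/-- The fibre of `f : E → ℙ¹(ℂ)` over `q`. -/
abbrev Fibre (f : MeromorphicFunction L) (q : OnePoint ℂ) : Type :=
  {x : EllipticCurve L // f.toSphere x = q}

/-- The branch locus `B ⊆ ℙ¹(ℂ)` of `f`. -/
def branchLocus (f : MeromorphicFunction L) : Set (OnePoint ℂ) :=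
  {p | ∃ x, f.toSphere x = p ∧ f.ramificationIndex x ≠ 1}

/-- `τ` is the permutation of the fibre over `q` given by the monodromy of `f` along the loop `γ`
based at `q`: each `x` in the fibre is the start of a lift of `γ` to `E` that ends at `τ x`.
(If `γ` avoids the branch locus, such a `τ` exists and is unique.) -/
def IsMonodromy (f : MeromorphicFunction L) {q : OnePoint ℂ} (γ : unitInterval → OnePoint ℂ)
    (τ : Equiv.Perm (f.Fibre q)) : Prop :=
  ∀ x : f.Fibre q, ∃ Γ : C(unitInterval, EllipticCurve L),
    Γ 0 = x ∧ Γ 1 = τ x ∧ ∀ t, f.toSphere (Γ t) = γ t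

/-- The monodromy group `M_f` based at `q ∉ B`, i.e. the image of the monodromy representation of
`π₁(ℙ¹ ∖ B, q)` in the permutations of the fibre over `q`. -/
def monodromyGroup (f : MeromorphicFunction L) (q : OnePoint ℂ) : Set (Equiv.Perm (f.Fibre q)) :=
  {τ | ∃ γ : Path q q, (∀ t, γ t ∉ f.branchLocus) ∧ f.IsMonodromy γ τ}

/-- The cover `f` is alternating: for every base point outside of the branch locus, and a numbering
of the fibre, the monodromy group lies in the alternating group `A_d`. -/
def IsAlternating (f : MeromorphicFunction L) : Prop :=
  ∀ q ∉ f.branchLocus, ∃ (d : ℕ) (e : f.Fibre q ≃ Fin d),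
    ∀ τ ∈ f.monodromyGroup q, e.permCongr τ ∈ alternatingGroup (Fin d)

/-- The circle of radius `r` around `p ∈ ℙ¹(ℂ)`, run through once counterclockwise, in the
coordinate `w - p` if `p ∈ ℂ` and in the coordinate `1 / w` if `p = ∞`. -/
def circleAround (p : OnePoint ℂ) (r : ℝ) (t : unitInterval) : OnePoint ℂ :=
  p.elim
    (((r * Complex.exp (2 * Real.pi * Complex.I * (t : ℝ)))⁻¹ : ℂ) : OnePoint ℂ)
    (fun a => ((a + r * Complex.exp (2 * Real.pi * Complex.I * (t : ℝ)) : ℂ) : OnePoint ℂ))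

/-- The local monodromy of `f` around `p` is a product of disjoint cycles of odd length:
for every small circle around `p`, every orbit of the monodromy permutation along
that circle has odd cardinality. -/
def HasOddLocalMonodromy (f : MeromorphicFunction L) (p : OnePoint ℂ) : Prop :=
  ∃ r₀ > (0 : ℝ), ∀ r : ℝ, 0 < r → r < r₀ →
    ∃ τ : Equiv.Perm (f.Fibre (circleAround p r 0)),
      f.IsMonodromy (circleAround p r) τ ∧ ∀ x, Odd (Function.minimalPeriod τ x)

/-- The cover `f : E → ℙ¹(ℂ)` given by a meromorphic function `f` is odd: it is a
non-constant map, alternating, and its local monodromies are products of cycles of odd length. -/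
structure IsOddCover (f : MeromorphicFunction L) : Prop where
  nonconstant : ¬ f.IsConstant
  alternating : f.IsAlternating
  odd_local : ∀ p ∈ f.branchLocus, f.HasOddLocalMonodromy p

/-- `R` is the ramification divisor `R_f = ∑ (e_x - 1) x`. -/
def IsRamificationDivisor (f : MeromorphicFunction L) (R : Divisor L) : Prop :=
  ∀ x, R x = f.ramificationIndex x - 1

/-- `A` is the divisor `f^*(p) = ∑_{f(x) = p} e_x x`. -/
def IsPullbackDivisor (f : MeromorphicFunction L) (p : OnePoint ℂ) (A : Divisor L) : Prop :=
  ∀ x, (f.toSphere x = p → A x = f.ramificationIndex x) ∧ (f.toSphere x ≠ p → A x = 0)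

/-- `ϑ = 𝒪_E(D) ⊗ f^* 𝒪_{ℙ¹}(-1)` where `D = R_f / 2`; here `f^* 𝒪_{ℙ¹}(1) = 𝒪_E(f^*(∞))`. -/
def HasSpinStructure (f : MeromorphicFunction L) (ϑ : Pic L) : Prop :=
  ∃ D A : Divisor L, f.IsRamificationDivisor (2 • D) ∧ f.IsPullbackDivisor ∞ A ∧
    ϑ = lineBundle D - lineBundle A

end MeromorphicFunction

/-- The equation `df = s² ω` of meromorphic differentials on `E`, for `ω = u dz`. -/
def SolvesEquation (f s : MeromorphicFunction L) (u : MeromorphicFunction L) : Prop :=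
  deriv f =ᶠ[codiscrete ℂ] fun z => s z ^ 2 * u z

end OddCover

end

/-!
# Odd covers of the sphere by an elliptic curve and the equation `df = s² ω`

*The spin structure is the equation.* The function `df / dz` on `E` has divisor `R_f - 2 f^*(∞)`.
If `div u = 2 T`, then `df = s² u dz` forces `R_f = 2 (div s + T + f^*(∞))`, so that
`D = R_f / 2` satisfies `𝒪(D) ⊗ f^* 𝒪(-1) = 𝒪(T)`. Conversely, if `R_f = 2 D` and
`D - f^*(∞) - T = div g`, then `df / dz` and `g² u` have the same divisor, hence are proportional,
and a square root of the constant of proportionality can be absorbed into `g`. This is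
`hasSpinStructure_iff`, applied with `T = 0`, `u = 1` and with `T = Q - P`, `u = h`.

*A spin structure makes the cover odd.* If `R_f` is divisible by two, all ramification indices are
odd, and the local monodromy, which permutes cyclically the `e_x` sheets that come together at `x`,
is a product of odd cycles (`IsBranchedCover.exists_rotation`). What remains is that the whole
monodromy group consists of even permutations (`IsBranchedCover.sign_monodromy`). This holds for
every branched cover of the sphere with odd ramification. Call an alternating sign function on the
pairs of points of a fibre, up to an even number of changes, an orientation of the fibre. A cycle of
odd length is even, so every small disc carries a locally constant orientation of the fibres over
its unbranched points, also if its centre is a branch point: two points of a fibre in the same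
sheet, with local coordinates `a`, `b` such that `a ^ e = b ^ e`, are compared by the sign of
`Im (a / b)`, which is nonzero since `e` is odd (`IsBranchedCover.exists_pairSign`). The
orientations of two discs differ on their overlap by a locally constant sign. These signs form a
cocycle on the sphere, which is a coboundary because the plane is simply connected and remains
connected without a finite set (`exists_coboundary`, `exists_sphere_coboundary`). So the local
orientations can be corrected to a global one (`IsBranchedCover.exists_orientation`), and this one
is preserved by the lifts of a loop: their permutation of the fibre is even.
-/

noncomputable section

namespace OddCover

/-! ### Charts of the Riemann sphere -/

/-- The inversion `w ↦ 1 / w` of the Riemann sphere. -/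
def sphereInv (q : OnePoint ℂ) : OnePoint ℂ :=
  open scoped Classical in
  q.elim ((0 : ℂ) : OnePoint ℂ) (fun u => if u = 0 then ∞ else ((u⁻¹ : ℂ) : OnePoint ℂ))

/-- The chart of the Riemann sphere centred at `p`: it sends `u` to `p + u` if `p` is finite, and to
`1 / u` if `p = ∞`. -/
def sphereChart (p : OnePoint ℂ) (u : ℂ) : OnePoint ℂ :=
  p.elim (sphereInv u) (fun a => ((a + u : ℂ) : OnePoint ℂ))

@[simp] lemma sphereInv_infty : sphereInv ∞ = ((0 : ℂ) : OnePoint ℂ) := rfl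

@[simp] lemma sphereInv_zero : sphereInv ((0 : ℂ) : OnePoint ℂ) = ∞ := by
  simp [sphereInv]

lemma sphereInv_coe {u : ℂ} (hu : u ≠ 0) : sphereInv u = ((u⁻¹ : ℂ) : OnePoint ℂ) := by
  simp [sphereInv, hu]

lemma sphereInv_sphereInv (q : OnePoint ℂ) : sphereInv (sphereInv q) = q := by
  induction q using OnePoint.rec with
  | infty => simp
  | coe u =>
    by_cases hu : u = 0
    · simp [hu]
    · rw [sphereInv_coe hu, sphereInv_coe (inv_ne_zero hu), inv_inv]

lemma continuous_sphereInv : Continuous sphereInv := by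
  rw [OnePoint.continuous_iff]
  constructor
  · rw [Filter.coclosedCompact_eq_cocompact, ← Metric.cobounded_eq_cocompact]
    have h : Tendsto (fun u : ℂ => ((u⁻¹ : ℂ) : OnePoint ℂ)) (Bornology.cobounded ℂ)
        (𝓝 ((0 : ℂ) : OnePoint ℂ)) :=
      (OnePoint.continuous_coe.tendsto 0).comp Filter.tendsto_inv₀_cobounded
    refine h.congr' ?_
    filter_upwards [Bornology.isBounded_singleton (x := (0 : ℂ))] with u hu
    exact (sphereInv_coe (by simpa using hu)).symm
  · rw [continuous_iff_continuousAt]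
    intro u
    by_cases hu : u = 0
    · subst hu
      rw [continuousAt_iff_punctured_nhds]
      have h : Tendsto (fun u : ℂ => ((u⁻¹ : ℂ) : OnePoint ℂ)) (𝓝[≠] 0) (𝓝 ∞) := by
        refine OnePoint.tendsto_coe_infty.comp ?_
        rw [Filter.coclosedCompact_eq_cocompact, ← Metric.cobounded_eq_cocompact]
        exact Filter.tendsto_inv₀_nhdsNE_zero
      change Tendsto _ _ (𝓝 (sphereInv ((0 : ℂ) : OnePoint ℂ)))
      rw [sphereInv_zero]
      refine h.congr' ?_
      filter_upwards [self_mem_nhdsWithin] with v hv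
      exact (sphereInv_coe hv).symm
    · have h : ContinuousAt (fun u : ℂ => ((u⁻¹ : ℂ) : OnePoint ℂ)) u :=
        OnePoint.continuous_coe.continuousAt.comp (continuousAt_inv₀ hu)
      refine h.congr ?_
      filter_upwards [isOpen_ne.mem_nhds hu] with v hv
      exact (sphereInv_coe hv).symm

lemma isOpenEmbedding_sphereChart (p : OnePoint ℂ) : IsOpenEmbedding (sphereChart p) := by
  induction p using OnePoint.rec with
  | infty =>
    let e : OnePoint ℂ ≃ₜ OnePoint ℂ :=
      ⟨⟨sphereInv, sphereInv, sphereInv_sphereInv, sphereInv_sphereInv⟩,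
        continuous_sphereInv, continuous_sphereInv⟩
    exact e.isOpenEmbedding.comp OnePoint.isOpenEmbedding_coe
  | coe a =>
    exact OnePoint.isOpenEmbedding_coe.comp (Homeomorph.addLeft a).isOpenEmbedding

lemma sphereChart_injective (p : OnePoint ℂ) : Function.Injective (sphereChart p) :=
  (isOpenEmbedding_sphereChart p).injective

lemma continuous_sphereChart (p : OnePoint ℂ) : Continuous (sphereChart p) :=
  (isOpenEmbedding_sphereChart p).continuous

@[simp] lemma sphereChart_coe (a u : ℂ) : sphereChart a u = ((a + u : ℂ) : OnePoint ℂ) := rfl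

lemma sphereChart_infty (u : ℂ) : sphereChart ∞ u = sphereInv u := rfl

@[simp] lemma sphereChart_zero (p : OnePoint ℂ) : sphereChart p 0 = p := by
  induction p using OnePoint.rec with
  | infty => exact sphereInv_zero
  | coe a => simp

/-- In the chart centred at `p`, the circle around `p` runs counterclockwise, also for `p = ∞`. -/
lemma circleAround_eq_sphereChart (p : OnePoint ℂ) {r : ℝ} (hr : 0 < r) (t : unitInterval) :
    MeromorphicFunction.circleAround p r t =
      sphereChart p (r * Complex.exp (2 * Real.pi * Complex.I * (t : ℝ))) := by
  induction p using OnePoint.rec with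
  | infty =>
    rw [sphereChart_infty, sphereInv_coe (mul_ne_zero (by exact_mod_cast hr.ne')
      (Complex.exp_ne_zero _))]
    rfl
  | coe a => rfl

/-! ### Branched covers of the sphere by a compact space -/

/-- `F : X → ℙ¹(ℂ)` is a branched cover with index `e x` at `x`: around every point `x` there is a
coordinate of `X`, centred at `x`, in which `F` reads `u ↦ u ^ (e x)`. -/
def IsBranchedCover {X : Type*} [TopologicalSpace X] (F : X → OnePoint ℂ) (e : X → ℕ) : Prop :=
  ∀ x, 0 < e x ∧ ∃ Φ : OpenPartialHomeomorph X ℂ, x ∈ Φ.source ∧ Φ x = 0 ∧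
    ∀ y ∈ Φ.source, F y = sphereChart (F x) (Φ y ^ e x)

/-- A coordinate disc of a branched cover at `x`, contained in a prescribed neighbourhood `U`. -/
structure CoordDisc {X : Type*} [TopologicalSpace X] (F : X → OnePoint ℂ) (e : X → ℕ) (x : X)
    (U : Set X) where
  chart : OpenPartialHomeomorph X ℂ
  radius : ℝ
  mem_source : x ∈ chart.source
  map_center : chart x = 0
  target_eq : chart.target = Metric.ball 0 radius
  map_eq : ∀ y ∈ chart.source, F y = sphereChart (F x) (chart y ^ e x)
  source_subset : chart.source ⊆ U

namespace IsBranchedCover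

variable {X : Type*} [TopologicalSpace X] {F : X → OnePoint ℂ} {e : X → ℕ}

lemma exists_coordDisc (hF : IsBranchedCover F e) (x : X) {U : Set X} (hU : IsOpen U)
    (hx : x ∈ U) : Nonempty (CoordDisc F e x U) := by
  obtain ⟨-, Φ, hxΦ, hΦx, hΦ⟩ := hF x
  let Ψ := Φ.restrOpen U hU
  have hxΨ : x ∈ Ψ.source := ⟨hxΦ, hx⟩
  have h0 : (0 : ℂ) ∈ Ψ.target := by
    have := Ψ.map_source hxΨ
    rwa [show Ψ x = 0 from hΦx] at this
  obtain ⟨ε, hε, hball⟩ := Metric.isOpen_iff.1 Ψ.open_target 0 h0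
  let Θ := (Ψ.symm.restrOpen (Metric.ball 0 ε) Metric.isOpen_ball).symm
  have hsub : Θ.source ⊆ Ψ.source := by
    intro y hy
    have h1 : Θ y ∈ Θ.target := Θ.map_source hy
    have h2 : Θ.symm (Θ y) = y := Θ.left_inv hy
    rw [← h2]
    exact Ψ.map_target h1.1
  refine ⟨⟨Θ, ε, ?_, hΦx, ?_, fun y hy => hΦ y (hsub hy).1, fun y hy => (hsub hy).2⟩⟩
  · have h1 : (0 : ℂ) ∈ Θ.target := ⟨h0, Metric.mem_ball_self hε⟩
    have h2 : Θ.symm 0 = x := by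
      have := Ψ.left_inv hxΨ
      rw [show Ψ x = 0 from hΦx] at this
      exact this
    rw [← h2]
    exact Θ.map_target h1
  · exact Set.inter_eq_right.2 hball

lemma continuous (hF : IsBranchedCover F e) : Continuous F := by
  rw [continuous_iff_continuousAt]
  intro x
  obtain ⟨-, Φ, hxΦ, hΦx, hΦ⟩ := hF x
  have h : ContinuousAt (fun y => sphereChart (F x) (Φ y ^ e x)) x :=
    (continuous_sphereChart _).continuousAt.comp ((Φ.continuousAt hxΦ).pow _)
  refine h.congr ?_
  filter_upwards [Φ.open_source.mem_nhds hxΦ] with y hy using (hΦ y hy).symm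

variable [CompactSpace X]

lemma finite_fibre (hF : IsBranchedCover F e) (p : OnePoint ℂ) : (F ⁻¹' {p}).Finite := by
  refine ((isClosed_singleton.preimage hF.continuous).isCompact).finite ?_
  refine isDiscrete_iff_forall_mem_exists_isOpen.2 fun x hx => ?_
  obtain ⟨he, Φ, hxΦ, hΦx, hΦ⟩ := hF x
  refine ⟨Φ.source, Φ.open_source, ?_⟩
  refine subset_antisymm (fun y hy => ?_) (Set.singleton_subset_iff.2 ⟨hxΦ, hx⟩)
  have h : sphereChart (F x) (Φ y ^ e x) = sphereChart (F x) 0 := by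
    rw [← hΦ y hy.1, sphereChart_zero]
    exact hy.2.trans hx.symm
  have h0 : Φ y = 0 := eq_zero_of_pow_eq_zero (sphereChart_injective _ h)
  exact Φ.injOn hy.1 hxΦ (h0.trans hΦx.symm)

variable [T2Space X]

lemma isCoveringMapOn (hF : IsBranchedCover F e) {s : Set (OnePoint ℂ)}
    (hs : ∀ x, F x ∈ s → e x = 1) : IsCoveringMapOn F s := by
  refine .of_isLocalHomeomorphOn hF.continuous (.mk _ _ fun x hx => ?_)
  obtain ⟨-, Φ, hxΦ, hΦx, hΦ⟩ := hF x
  refine ⟨Φ.trans ((isOpenEmbedding_sphereChart (F x)).toOpenPartialHomeomorph _), by simp [hxΦ], ?_⟩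
  intro y hy
  have hy' : y ∈ Φ.source := by simpa using hy
  simp [hΦ y hy', hs x hx]

end IsBranchedCover

/-! ### Sheets over a small disc -/

namespace IsBranchedCover

variable {X : Type*} [TopologicalSpace X] [CompactSpace X] [T2Space X] {F : X → OnePoint ℂ}
  {e : X → ℕ}

/-- Over a small disc around `p` the cover is the disjoint union of coordinate discs around the
points of the fibre over `p`. -/
lemma exists_sheets (hF : IsBranchedCover F e) (p : OnePoint ℂ) :
    ∃ δ > (0 : ℝ), ∃ V : X → Set X, (F ⁻¹' {p}).PairwiseDisjoint V ∧
      ∃ D : ∀ x, CoordDisc F e x (V x),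
        ∀ y u, ‖u‖ < δ → F y = sphereChart p u → ∃ x, F x = p ∧ y ∈ (D x).chart.source := by
  obtain ⟨V, hV, hdisj⟩ := (hF.finite_fibre p).t2_separation
  let D : ∀ x, CoordDisc F e x (V x) :=
    fun x => (hF.exists_coordDisc x (hV x).2 (hV x).1).some
  let W : Set X := ⋃ x ∈ F ⁻¹' {p}, (D x).chart.source
  have hW : IsOpen W := isOpen_biUnion fun x _ => (D x).chart.open_source
  have hclosed : IsClosed (F '' Wᶜ) := hF.continuous.isClosedMap _ hW.isClosed_compl
  have hp : p ∈ (F '' Wᶜ)ᶜ := by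
    rintro ⟨x, hx, hxp⟩
    exact hx (Set.mem_biUnion hxp (D x).mem_source)
  have hnhds : sphereChart p ⁻¹' (F '' Wᶜ)ᶜ ∈ 𝓝 (0 : ℂ) := by
    refine (continuous_sphereChart p).continuousAt.preimage_mem_nhds ?_
    rw [sphereChart_zero]
    exact hclosed.isOpen_compl.mem_nhds hp
  obtain ⟨δ, hδ, hball⟩ := Metric.mem_nhds_iff.1 hnhds
  refine ⟨δ, hδ, V, hdisj, D, fun y u hu hy => ?_⟩
  have h1 : y ∈ W := by
    by_contra hyW
    exact hball (mem_ball_zero_iff.2 hu) ⟨y, hyW, hy⟩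
  simpa [W] using h1

end IsBranchedCover

lemma CoordDisc.pow_eq {X : Type*} [TopologicalSpace X] {F : X → OnePoint ℂ} {e : X → ℕ} {x : X}
    {U : Set X} (D : CoordDisc F e x U) {y : X} (hy : y ∈ D.chart.source) {u : ℂ}
    (h : F y = sphereChart (F x) u) : D.chart y ^ e x = u :=
  sphereChart_injective _ ((D.map_eq y hy).symm.trans h)

lemma eventually_sign_eq {α : Type*} [TopologicalSpace α] {g : α → ℝ} {x : α}
    (hg : ContinuousAt g x) (hx : g x ≠ 0) :
    ∀ᶠ y in 𝓝 x, SignType.sign (g y) = SignType.sign (g x) := by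
  have h : ContinuousAt (fun y => SignType.sign (g y)) x :=
    ContinuousAt.comp (continuousAt_sign_of_ne_zero hx) hg
  exact h.preimage_mem_nhds ((isOpen_discrete {SignType.sign (g x)}).mem_nhds rfl)

/-- Two distinct roots `a, b` of the same odd order of the same number have a quotient that is not
real, since `-1` is not a root of unity of odd order. -/
lemma im_div_ne_zero {a b : ℂ} {n : ℕ} (hn : Odd n) (hab : a ^ n = b ^ n) (hne : a ≠ b) :
    (a / b).im ≠ 0 := by
  intro him
  have hb : b ≠ 0 := by
    rintro rfl
    rw [zero_pow hn.pos.ne'] at hab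
    exact hne (eq_zero_of_pow_eq_zero hab)
  have h1 : (a / b) ^ n = 1 := by rw [div_pow, hab, div_self (pow_ne_zero _ hb)]
  have h2 : a / b = ((a / b).re : ℂ) := by
    apply Complex.ext <;> simp [him]
  rw [h2] at h1
  have h3 : (a / b).re ^ n = 1 := by exact_mod_cast h1
  have h4 : (a / b).re = 1 := by
    have := hn.strictMono_pow (R := ℝ)
    exact this.injective (by simpa using h3)
  rw [h4] at h2
  exact hne ((div_eq_one_iff_eq hb).1 (by simpa using h2))

lemma sign_im_div (a b : ℂ) :
    SignType.sign (a / b).im = -SignType.sign (b / a).im := by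
  have h : (a / b).im = -((Complex.normSq a / Complex.normSq b) * (b / a).im) := by
    by_cases ha : a = 0
    · simp [ha]
    by_cases hb : b = 0
    · simp [hb]
    have ha' : Complex.normSq a ≠ 0 := by simpa using ha
    have hb' : Complex.normSq b ≠ 0 := by simpa using hb
    rw [Complex.div_im, Complex.div_im]
    field_simp
    ring
  by_cases ha : a = 0
  · simp [ha]
  by_cases hb : b = 0
  · simp [hb]
  have hpos : 0 < Complex.normSq a / Complex.normSq b :=
    div_pos (Complex.normSq_pos.2 ha) (Complex.normSq_pos.2 hb)
  rw [h, Left.sign_neg, sign_mul, sign_pos hpos, one_mul]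

namespace IsBranchedCover

variable {X : Type*} [TopologicalSpace X] [CompactSpace X] [T2Space X] {F : X → OnePoint ℂ}
  {e : X → ℕ}

/-- If all indices over `p` are odd, there is a locally constant antisymmetric sign `a x y` on the
pairs of distinct points `x ≠ y` in a common fibre near `p`. On different sheets it compares the
sheets in a fixed order; on the same sheet, where the coordinates of `x` and `y` are two roots of
odd order of the same number, it is the sign of the imaginary part of their quotient. -/
lemma exists_pairSign (hF : IsBranchedCover F e) (p : OnePoint ℂ)
    (hodd : ∀ x, F x = p → Odd (e x)) :
    ∃ δ > (0 : ℝ), ∃ a : X → X → ℤ, (∀ x y, a x y = -a y x) ∧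
      ∀ x y u, ‖u‖ < δ → F x = sphereChart p u → F y = sphereChart p u → x ≠ y →
        a x y ^ 2 = 1 ∧ ∀ᶠ q in 𝓝 (x, y), a q.1 q.2 = a x y := by
  classical
  obtain ⟨δ, hδ, V, hdisj, D, hD⟩ := hF.exists_sheets p
  have : Finite (F ⁻¹' {p}) := hF.finite_fibre p
  obtain ⟨d, ⟨num⟩⟩ := Finite.exists_equiv_fin (F ⁻¹' {p})
  have huniq : ∀ z z' y, F z = p → F z' = p → y ∈ (D z).chart.source →
      y ∈ (D z').chart.source → z = z' := by
    intro z z' y hz hz' h h'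
    by_contra hne
    exact Set.disjoint_left.1 (hdisj hz hz' hne) ((D z).source_subset h) ((D z').source_subset h')
  let sheet : X → X := fun y =>
    if h : ∃ z, F z = p ∧ y ∈ (D z).chart.source then h.choose else y
  have hsheet : ∀ z y, F z = p → y ∈ (D z).chart.source → sheet y = z := by
    intro z y hz hy
    have h : ∃ z, F z = p ∧ y ∈ (D z).chart.source := ⟨z, hz, hy⟩
    simp only [sheet, dif_pos h]
    exact huniq _ _ y h.choose_spec.1 hz h.choose_spec.2 hy
  let rk : X → ℝ := fun z => if h : F z = p then (num ⟨z, h⟩ : ℕ) else 0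
  have hrk : ∀ z z', F z = p → F z' = p → rk z = rk z' → z = z' := by
    intro z z' hz hz' h
    simp only [rk, dif_pos hz, dif_pos hz', Nat.cast_inj] at h
    exact congrArg Subtype.val (num.injective (Fin.ext h))
  let ψ : X → ℂ := fun y => (D (sheet y)).chart y
  let a : X → X → ℤ := fun x y =>
    if sheet x = sheet y then (SignType.sign (ψ x / ψ y).im : ℤ)
    else (SignType.sign (rk (sheet x) - rk (sheet y)) : ℤ)
  refine ⟨δ, hδ, a, fun x y => ?_, fun x y u hu hx hy hxy => ?_⟩
  · by_cases h : sheet x = sheet y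
    · simp only [a, if_pos h, if_pos h.symm]
      rw [sign_im_div, SignType.coe_neg]
    · simp only [a, if_neg h, if_neg (Ne.symm h)]
      rw [← neg_sub (rk (sheet y)), Left.sign_neg, SignType.coe_neg]
  · obtain ⟨z, hz, hxz⟩ := hD x u hu hx
    obtain ⟨z', hz', hyz'⟩ := hD y u hu hy
    have hsx := hsheet z x hz hxz
    have hsy := hsheet z' y hz' hyz'
    have hnear : ∀ᶠ q : X × X in 𝓝 (x, y), q.1 ∈ (D z).chart.source ∧ q.2 ∈ (D z').chart.source :=
      ((D z).chart.open_source.prod (D z').chart.open_source).mem_nhds ⟨hxz, hyz'⟩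
    have hsq : ∀ r : ℝ, r ≠ 0 → (SignType.sign r : ℤ) ^ 2 = 1 := by
      intro r hr
      rcases hr.lt_or_gt with h | h
      · simp [sign_neg h]
      · simp [sign_pos h]
    by_cases hzz : z = z'
    · subst hzz
      have hne : ((D z).chart x / (D z).chart y).im ≠ 0 := by
        refine im_div_ne_zero (hodd z hz) ?_ fun h => hxy ((D z).chart.injOn hxz hyz' h)
        rw [(D z).pow_eq hxz (u := u) (by rw [hz, hx]), (D z).pow_eq hyz' (u := u) (by rw [hz, hy])]
      have hval : ∀ q : X × X, q.1 ∈ (D z).chart.source ∧ q.2 ∈ (D z).chart.source →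
          a q.1 q.2 = SignType.sign ((D z).chart q.1 / (D z).chart q.2).im := by
        rintro q ⟨h1, h2⟩
        simp only [a, ψ, if_pos ((hsheet z _ hz h1).trans (hsheet z _ hz h2).symm)]
        rw [hsheet z _ hz h1, hsheet z _ hz h2]
      have hy0 : (D z).chart y ≠ 0 := by
        intro h
        simp [h] at hne
      have hcont : ContinuousAt (fun q : X × X => ((D z).chart q.1 / (D z).chart q.2).im) (x, y) :=
        Complex.continuous_im.continuousAt.comp
          ((((D z).chart.continuousAt hxz).comp continuousAt_fst).div
            (((D z).chart.continuousAt hyz').comp continuousAt_snd) hy0)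
      rw [hval (x, y) ⟨hxz, hyz'⟩]
      refine ⟨hsq _ hne, ?_⟩
      filter_upwards [hnear, eventually_sign_eq hcont hne] with q hq hq'
      rw [hval q hq, hq']
    · have hval : ∀ q : X × X, q.1 ∈ (D z).chart.source ∧ q.2 ∈ (D z').chart.source →
          a q.1 q.2 = SignType.sign (rk z - rk z') := by
        rintro q ⟨h1, h2⟩
        simp only [a, hsheet z _ hz h1, hsheet z' _ hz' h2, if_neg hzz]
      rw [hval (x, y) ⟨hxz, hyz'⟩]
      refine ⟨hsq _ (sub_ne_zero.2 fun h => hzz (hrk _ _ hz hz' h)), ?_⟩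
      filter_upwards [hnear] with q hq using hval q hq

/-- If all indices over `p` are odd, the monodromy along a small circle around `p` exists, and all
its orbits are odd: it turns the coordinate of a sheet of index `n` by `exp (2πi / n)`. -/
lemma exists_rotation (hF : IsBranchedCover F e) (p : OnePoint ℂ)
    (hodd : ∀ x, F x = p → Odd (e x)) :
    ∃ δ > (0 : ℝ), ∀ r : ℝ, 0 < r → r < δ →
      ∃ τ : Equiv.Perm {x // F x = sphereChart p r},
        (∀ x : {x // F x = sphereChart p r}, ∃ Γ : C(unitInterval, X), Γ 0 = x ∧ Γ 1 = τ x ∧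
          ∀ t, F (Γ t) = sphereChart p (r * Complex.exp (2 * Real.pi * Complex.I * (t : ℝ)))) ∧
        ∀ x, Odd (Function.minimalPeriod τ x) := by
  obtain ⟨δ, hδ, V, hdisj, D, hD⟩ := hF.exists_sheets p
  have huniq : ∀ z z' y, F z = p → F z' = p → y ∈ (D z).chart.source →
      y ∈ (D z').chart.source → z = z' := by
    intro z z' y hz hz' h h'
    by_contra hne
    exact Set.disjoint_left.1 (hdisj hz hz' hne) ((D z).source_subset h) ((D z').source_subset h')
  refine ⟨δ, hδ, fun r hr hrδ => ?_⟩
  let Y := {x // F x = sphereChart p r}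
  have hfin : Finite Y := hF.finite_fibre (sphereChart p r)
  have hsh : ∀ y : Y, ∃ z, F z = p ∧ (y : X) ∈ (D z).chart.source := fun y =>
    hD y r (by simpa [abs_of_pos hr] using hrδ) y.2
  choose sh hshp hshm using hsh
  -- the point over `r * exp (2πit)` obtained by turning `y` in its sheet
  let g : X → X → ℝ → X := fun z y t =>
    (D z).chart.symm ((D z).chart y * Complex.exp (2 * Real.pi * Complex.I * t / e z))
  have hnorm : ∀ (z : X) (t : ℝ), ‖Complex.exp (2 * Real.pi * Complex.I * t / e z)‖ = 1 := by
    intro z t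
    have : 2 * Real.pi * Complex.I * t / e z = ((2 * Real.pi * t / e z : ℝ) : ℂ) * Complex.I := by
      push_cast; ring
    rw [this, Complex.norm_exp_ofReal_mul_I]
  have htarget : ∀ z y t, y ∈ (D z).chart.source →
      (D z).chart y * Complex.exp (2 * Real.pi * Complex.I * (t : ℝ) / e z)
        ∈ (D z).chart.target := by
    intro z y t hy
    have := (D z).chart.map_source hy
    rw [(D z).target_eq, mem_ball_zero_iff] at this ⊢
    rwa [norm_mul, hnorm, mul_one]
  have hgmem : ∀ z y t, y ∈ (D z).chart.source → g z y t ∈ (D z).chart.source :=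
    fun z y t hy => (D z).chart.map_target (htarget z y t hy)
  have hgF : ∀ z y t, F z = p → y ∈ (D z).chart.source → F y = sphereChart p r →
      F (g z y t) = sphereChart p (r * Complex.exp (2 * Real.pi * Complex.I * t)) := by
    intro z y t hz hy hyr
    rw [(D z).map_eq _ (hgmem z y t hy), (D z).chart.right_inv (htarget z y t hy), mul_pow,
      (D z).pow_eq hy (u := r) (by rw [hz, hyr]), hz, ← Complex.exp_nat_mul]
    have : (e z : ℂ) ≠ 0 := by exact_mod_cast (hF z).1.ne'
    rw [mul_div_cancel₀ _ this]
  have hg1 : ∀ z y, F z = p → y ∈ (D z).chart.source → F y = sphereChart p r →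
      F (g z y 1) = sphereChart p r := by
    intro z y hz hy hyr
    rw [hgF z y 1 hz hy hyr]
    simp
  let τ : Y → Y := fun y => ⟨g (sh y) y 1, hg1 _ _ (hshp y) (hshm y) y.2⟩
  have hτsh : ∀ y, sh (τ y) = sh y := fun y =>
    huniq _ _ (τ y) (hshp _) (hshp _) (hshm _) (hgmem _ _ _ (hshm y))
  have hiter : ∀ (n : ℕ) (y : Y), sh (τ^[n] y) = sh y ∧ ((τ^[n] y : Y) : X) = g (sh y) y n := by
    intro n y
    induction n with
    | zero => simp [g, (D (sh y)).chart.left_inv (hshm y)]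
    | succ n ih =>
      rw [Function.iterate_succ_apply']
      refine ⟨(hτsh _).trans ih.1, ?_⟩
      change g (sh (τ^[n] y)) (τ^[n] y : Y) 1 = _
      rw [ih.1, ih.2]
      simp only [g]
      rw [(D (sh y)).chart.right_inv (by simpa using htarget (sh y) y n (hshm y)), mul_assoc,
        ← Complex.exp_add]
      congr 3
      push_cast
      ring
  have hper : ∀ y, Function.IsPeriodicPt τ (e (sh y)) y := by
    intro y
    have : (e (sh y) : ℂ) ≠ 0 := by exact_mod_cast (hF (sh y)).1.ne'
    refine Subtype.ext ?_
    rw [(hiter _ y).2]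
    simp only [g, Complex.ofReal_natCast]
    rw [mul_div_assoc, div_self this, mul_one, Complex.exp_two_pi_mul_I, mul_one,
      (D (sh y)).chart.left_inv (hshm y)]
  have hsurj : Function.Surjective τ := by
    intro y
    refine ⟨τ^[e (sh y) - 1] y, ?_⟩
    rw [← Function.iterate_succ_apply' τ, Nat.succ_eq_add_one, Nat.sub_add_cancel (hF (sh y)).1]
    exact hper y
  refine ⟨Equiv.ofBijective τ (Finite.surjective_iff_bijective.1 hsurj), fun y => ?_, fun y => ?_⟩
  · refine ⟨⟨fun t => g (sh y) y t, ?_⟩, ?_, rfl, fun t => hgF _ _ _ (hshp y) (hshm y) y.2⟩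
    · rw [continuous_iff_continuousAt]
      intro t
      refine ContinuousAt.comp (g := (D (sh y)).chart.symm) (f := fun t : unitInterval =>
        (D (sh y)).chart y * Complex.exp (2 * Real.pi * Complex.I * (t : ℝ) / e (sh y)))
        ((D (sh y)).chart.continuousAt_symm (htarget _ _ _ (hshm y))) ?_
      fun_prop
    · change g (sh y) y ((0 : unitInterval) : ℝ) = y
      simp [g, (D (sh y)).chart.left_inv (hshm y)]
  · exact (hodd _ (hshp y)).of_dvd_nat (hper y).minimalPeriod_dvd

end IsBranchedCover

/-! ### Gluing locally constant data on the plane and on the sphere -/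

lemma eq_of_eventually_eq_of_isPreconnected {Y α : Type*} [TopologicalSpace Y] {S : Set Y}
    (hS : IsPreconnected S) {g : Y → α} (hg : ∀ x ∈ S, ∀ᶠ y in 𝓝[S] x, g y = g x) {x y : Y}
    (hx : x ∈ S) (hy : y ∈ S) : g x = g y := by
  let : TopologicalSpace α := ⊥
  have : DiscreteTopology α := ⟨rfl⟩
  refine hS.constant (f := g) (fun z hz => ?_) hx hy
  refine (tendsto_const_nhds (x := g z)).congr' ?_
  filter_upwards [hg z hz] with w hw using hw.symm

/-- An open convex subset of the plane stays connected when finitely many points are removed: two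
points can be joined through a point of the perpendicular bisector close to their midpoint. -/
lemma isPreconnected_diff_finite {U B : Set ℂ} (hU : IsOpen U) (hc : Convex ℝ U) (hB : B.Finite) :
    IsPreconnected (U \ B) := by
  have key : ∀ w b v : ℂ, ∀ η : ℝ, η ≠ 0 → b ≠ w → v ≠ 0 →
      ∀ᶠ s : ℝ in 𝓝[≠] 0, b ∉ segment ℝ w (w + v * (1 / 2 + Complex.I * (η * s))) := by
    intro w b v η hη hbw hv
    -- at most one `s` puts `b` on the segment: the direction `(b - w) / v` determines `s`
    have hsub : {s : ℝ | b ∈ segment ℝ w (w + v * (1 / 2 + Complex.I * (η * s)))}.Subsingleton := by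
      have h : ∀ s : ℝ, b ∈ segment ℝ w (w + v * (1 / 2 + Complex.I * (η * s))) →
          ((b - w) / v).re ≠ 0 ∧ s = ((b - w) / v).im / (2 * η * ((b - w) / v).re) := by
        intro s hs
        rw [segment_eq_image'] at hs
        obtain ⟨θ, -, hθ⟩ := hs
        have h1 : (b - w) / v = θ * (1 / 2 + Complex.I * (η * s)) := by
          rw [← hθ]
          simp only [add_sub_cancel_left, Complex.real_smul]
          field_simp
        have hθ0 : θ ≠ 0 := by
          rintro rfl
          exact hbw (by simpa using hθ.symm)
        have hre : ((b - w) / v).re = θ / 2 := by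
          rw [h1]; simp; ring
        have him : ((b - w) / v).im = θ * (η * s) := by
          rw [h1]; simp
        rw [hre, him]
        refine ⟨by simpa using hθ0, ?_⟩
        field_simp
      intro s hs s' hs'
      rw [(h s hs).2, (h s' hs').2]
    have := hsub.finite.isClosed.isOpen_compl
    by_cases h0 : (0 : ℝ) ∈ {s : ℝ | b ∈ segment ℝ w (w + v * (1 / 2 + Complex.I * (η * s)))}
    · filter_upwards [self_mem_nhdsWithin] with s hs hs'
      exact hs (hsub hs' h0)
    · exact mem_nhdsWithin_of_mem_nhds (this.mem_nhds h0)
  refine isPreconnected_of_forall_pair fun x hx y hy => ?_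
  by_cases hxy : x = y
  · subst hxy
    exact ⟨{x}, by simpa using hx, rfl, rfl, isPreconnected_singleton⟩
  have hv : y - x ≠ 0 := sub_ne_zero.2 (Ne.symm hxy)
  have h1 : ∀ᶠ s : ℝ in 𝓝[≠] 0, ∀ b ∈ B,
      b ∉ segment ℝ x (x + (y - x) * (1 / 2 + Complex.I * ((1 : ℝ) * s))) :=
    (Filter.eventually_all_finite hB).2 fun b hb =>
      key x b (y - x) 1 one_ne_zero (fun h => hx.2 (h ▸ hb)) hv
  have h2 : ∀ᶠ s : ℝ in 𝓝[≠] 0, ∀ b ∈ B,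
      b ∉ segment ℝ y (y + (x - y) * (1 / 2 + Complex.I * ((-1 : ℝ) * s))) :=
    (Filter.eventually_all_finite hB).2 fun b hb =>
      key y b (x - y) (-1) (by norm_num) (fun h => hy.2 (h ▸ hb)) (sub_ne_zero.2 hxy)
  have h3 : ∀ᶠ s : ℝ in 𝓝[≠] 0,
      x + (y - x) * (1 / 2 + Complex.I * ((1 : ℝ) * s)) ∈ U := by
    have hcont : Continuous fun s : ℝ => x + (y - x) * (1 / 2 + Complex.I * ((1 : ℝ) * s)) := by
      fun_prop
    refine mem_nhdsWithin_of_mem_nhds (hcont.continuousAt.preimage_mem_nhds (hU.mem_nhds ?_))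
    have := hc hx.1 hy.1 (a := 1 / 2) (b := 1 / 2) (by norm_num) (by norm_num) (by norm_num)
    convert this using 1
    simp only [Complex.real_smul]
    push_cast
    ring
  obtain ⟨s, hs1, hs2, hs3⟩ := (h1.and (h2.and h3)).exists
  have hz : y + (x - y) * (1 / 2 + Complex.I * ((-1 : ℝ) * s)) =
      x + (y - x) * (1 / 2 + Complex.I * ((1 : ℝ) * s)) := by
    push_cast; ring
  rw [hz] at hs2
  set z := x + (y - x) * (1 / 2 + Complex.I * ((1 : ℝ) * s))
  refine ⟨segment ℝ x z ∪ segment ℝ y z, ?_, Or.inl (left_mem_segment ℝ x z),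
    Or.inr (left_mem_segment ℝ y z), ?_⟩
  · rintro w (hw | hw)
    · exact ⟨hc.segment_subset hx.1 hs3 hw, fun hb => hs1 w hb hw⟩
    · exact ⟨hc.segment_subset hy.1 hs3 hw, fun hb => hs2 w hb hw⟩
  · exact IsPreconnected.union z (right_mem_segment ℝ x z) (right_mem_segment ℝ y z)
      (convex_segment x z).isPreconnected (convex_segment y z).isPreconnected

/-- Every constant cocycle on a cover of the plane by connected open sets is a coboundary: it
defines a covering space of the plane, which has a section as the plane is simply connected. -/
lemma exists_coboundary {G : Type*} [CommGroup G] (U : ℂ → Set ℂ) (hU : ∀ p, IsOpen (U p))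
    (hconn : ∀ p, IsPreconnected (U p)) (hmem : ∀ p, p ∈ U p) (C : ℂ → ℂ → G)
    (hC1 : ∀ p, C p p = 1)
    (hC : ∀ p q r, (U p ∩ U q ∩ U r).Nonempty → C p q * C q r = C p r) :
    ∃ s : ℂ → G, ∀ p q, (U p ∩ U q).Nonempty → s q = C p q * s p := by
  let : TopologicalSpace G := ⊥
  have : DiscreteTopology G := ⟨rfl⟩
  let Z : FiberBundleCore ℂ ℂ G :=
    { baseSet := U
      isOpen_baseSet := hU
      indexAt := fun p => p
      mem_baseSet_at := hmem
      coordChange := fun i j _ v => C i j * v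
      coordChange_self := fun i x _ v => by rw [hC1, one_mul]
      continuousOn_coordChange := fun i j =>
        ((continuous_of_discreteTopology (f := fun v : G => C i j * v)).comp
          continuous_snd).continuousOn
      coordChange_comp := fun i j k x hx v => by
        rw [← mul_assoc, mul_comm (C j k), hC i j k ⟨x, hx⟩] }
  have hcov : IsCoveringMap (Bundle.TotalSpace.proj : Bundle.TotalSpace G Z.Fiber → ℂ) :=
    FiberBundle.isCoveringMap
  obtain ⟨σ, ⟨-, hσ⟩, -⟩ := hcov.existsUnique_continuousMap_lifts (ContinuousMap.id ℂ) 0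
    ⟨0, (1 : G)⟩ rfl
  have hσx : ∀ x, (σ x).proj = x := fun x => congrFun hσ x
  -- the section `σ`, read in the trivialization over `U p`
  let val : ℂ → ℂ → G := fun p x => (Z.localTriv p (σ x)).2
  have hval : ∀ p q x, x ∈ U p → x ∈ U q → val q x = C p q * val p x := by
    intro p q x hp hq
    have h := Z.coordChange_comp (Z.indexAt (σ x).proj) p q (σ x).proj
      ⟨⟨hmem _, by rwa [hσx x]⟩, by rwa [hσx x]⟩ (σ x).2
    exact h.symm
  have hconst : ∀ p x y, x ∈ U p → y ∈ U p → val p x = val p y := by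
    intro p x y hx hy
    refine (hconn p).constant (f := val p) ?_ hx hy
    refine continuous_snd.comp_continuousOn ((Z.localTriv p).continuousOn.comp
      σ.continuous.continuousOn fun z hz => ?_)
    rw [Z.mem_localTriv_source]
    change (σ z).proj ∈ U p
    rwa [hσx z]
  refine ⟨fun p => val p p, fun p q ⟨x, hp, hq⟩ => ?_⟩
  change val q q = C p q * val p p
  rw [hconst q q x (hmem q) hq, hval p q x hp hq, hconst p x p hp (hmem p)]

/-- A locally constant cocycle on a cover of the sphere by coordinate discs is a coboundary, even if
it is only defined outside of a finite set `B`. -/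
lemma exists_sphere_coboundary {G : Type*} [CommGroup G] {δ : OnePoint ℂ → ℝ} (hδ : ∀ p, 0 < δ p)
    {B : Set (OnePoint ℂ)} (hB : B.Finite) {U : OnePoint ℂ → Set (OnePoint ℂ)}
    (hU : ∀ p, U p = sphereChart p '' Metric.ball 0 (δ p))
    (c : OnePoint ℂ → OnePoint ℂ → OnePoint ℂ → G)
    (h1 : ∀ p w, w ∈ U p → w ∉ B → c p p w = 1)
    (h2 : ∀ p q r w, w ∈ U p → w ∈ U q → w ∈ U r → w ∉ B → c p q w * c q r w = c p r w)
    (h3 : ∀ p q w, w ∈ U p → w ∈ U q → w ∉ B → ∀ᶠ w' in 𝓝 w, c p q w' = c p q w) :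
    ∃ s : OnePoint ℂ → G, ∀ p q w, w ∈ U p → w ∈ U q → w ∉ B → s q = c p q w * s p := by
  classical
  have hUo : ∀ p, IsOpen (U p) := fun p => by
    rw [hU]
    exact (isOpenEmbedding_sphereChart p).isOpenMap _ Metric.isOpen_ball
  have hpU : ∀ p, p ∈ U p := fun p => by
    rw [hU]
    exact ⟨0, Metric.mem_ball_self (hδ p), sphereChart_zero p⟩
  have hUc : ∀ a b : ℂ, (b : OnePoint ℂ) ∈ U a ↔ b ∈ Metric.ball a (δ a) := by
    intro a b
    rw [hU]
    constructor
    · rintro ⟨u, hu, hub⟩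
      rw [sphereChart_coe, OnePoint.coe_eq_coe] at hub
      rw [← hub]
      simpa using hu
    · intro hb
      exact ⟨b - a, by simpa [dist_eq_norm] using hb, by simp⟩
  let Bc : Set ℂ := {b | (b : OnePoint ℂ) ∈ B}
  have hBc : Bc.Finite := hB.preimage OnePoint.coe_injective.injOn
  let V : ℂ → Set ℂ := fun a => Metric.ball a (δ a)
  have hconst : ∀ a a' x y, x ∈ (V a ∩ V a') \ Bc → y ∈ (V a ∩ V a') \ Bc →
      c a a' x = c a a' y := by
    intro a a' x y hx hy
    refine eq_of_eventually_eq_of_isPreconnected (g := fun x : ℂ => c a a' x)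
      (isPreconnected_diff_finite (Metric.isOpen_ball.inter Metric.isOpen_ball)
        ((convex_ball _ _).inter (convex_ball _ _)) hBc) (fun z hz => ?_) hx hy
    exact mem_nhdsWithin_of_mem_nhds (OnePoint.continuous_coe.continuousAt.eventually
      (h3 a a' z ((hUc _ _).2 hz.1.1) ((hUc _ _).2 hz.1.2) hz.2))
  -- overlaps of discs in the plane are convex, so that the cocycle is constant on them
  let C : ℂ → ℂ → G := fun a a' =>
    if h : ((V a ∩ V a') \ Bc).Nonempty then c a a' h.some else 1
  have hC : ∀ a a' x, x ∈ V a → x ∈ V a' → x ∉ Bc → C a a' = c a a' x := by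
    intro a a' x hx hx' hxB
    have h : ((V a ∩ V a') \ Bc).Nonempty := ⟨x, ⟨hx, hx'⟩, hxB⟩
    simp only [C, dif_pos h]
    exact hconst _ _ _ _ h.some_mem ⟨⟨hx, hx'⟩, hxB⟩
  have hne : ∀ W : Set ℂ, IsOpen W → W.Nonempty → ∃ x ∈ W, x ∉ Bc := fun W hW hW' =>
    (hBc.countable.dense_compl ℝ).inter_open_nonempty W hW hW'
  obtain ⟨s, hs⟩ := exists_coboundary V (fun _ => Metric.isOpen_ball)
    (fun a => (convex_ball _ _).isPreconnected) (fun a => Metric.mem_ball_self (hδ a)) C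
    (fun a => by
      obtain ⟨x, hx, hxB⟩ := hne (V a) Metric.isOpen_ball ⟨a, Metric.mem_ball_self (hδ a)⟩
      rw [hC a a x hx hx hxB, h1 a x ((hUc _ _).2 hx) hxB])
    (fun a a' a'' h => by
      obtain ⟨x, ⟨⟨hx, hx'⟩, hx''⟩, hxB⟩ := hne (V a ∩ V a' ∩ V a'')
        ((Metric.isOpen_ball.inter Metric.isOpen_ball).inter Metric.isOpen_ball) h
      rw [hC a a' x hx hx' hxB, hC a' a'' x hx' hx'' hxB, hC a a'' x hx hx'' hxB]
      exact h2 _ _ _ _ ((hUc _ _).2 hx) ((hUc _ _).2 hx') ((hUc _ _).2 hx'') hxB)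
  have hs' : ∀ a a' x : ℂ, (x : OnePoint ℂ) ∈ U a → (x : OnePoint ℂ) ∈ U a' →
      (x : OnePoint ℂ) ∉ B → s a' = c a a' x * s a := by
    intro a a' x hx hx' hxB
    rw [hs a a' ⟨x, (hUc _ _).1 hx, (hUc _ _).1 hx'⟩,
      hC a a' x ((hUc _ _).1 hx) ((hUc _ _).1 hx') hxB]
  -- the value at `∞`, computed at the point `u⁻¹` close to `∞`
  let g : ℂ → G := fun u => c ((u⁻¹ : ℂ) : OnePoint ℂ) ∞ ((u⁻¹ : ℂ) : OnePoint ℂ) * s u⁻¹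
  let T : Set ℂ := Metric.ball 0 (δ ∞) \ insert 0 (sphereChart ∞ ⁻¹' B)
  have hTfin : (insert 0 (sphereChart ∞ ⁻¹' B)).Finite :=
    (hB.preimage (sphereChart_injective ∞).injOn).insert 0
  have hT : ∀ u ∈ T, ((u⁻¹ : ℂ) : OnePoint ℂ) ∈ U ∞ ∧ ((u⁻¹ : ℂ) : OnePoint ℂ) ∉ B ∧ u ≠ 0 := by
    rintro u ⟨hu, hu'⟩
    have hu0 : u ≠ 0 := fun h => hu' (Or.inl h)
    rw [← sphereInv_coe hu0]
    exact ⟨by rw [hU]; exact ⟨u, hu, rfl⟩, fun h => hu' (Or.inr h), hu0⟩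
  have hgconst : ∀ u ∈ T, ∀ v ∈ T, g u = g v := by
    intro u hu v hv
    refine eq_of_eventually_eq_of_isPreconnected (isPreconnected_diff_finite Metric.isOpen_ball
      (convex_ball _ _) hTfin) (fun u hu => ?_) hu hv
    obtain ⟨hu1, hu2, hu0⟩ := hT u hu
    have hcont : Tendsto (fun v : ℂ => ((v⁻¹ : ℂ) : OnePoint ℂ)) (𝓝[T] u)
        (𝓝 ((u⁻¹ : ℂ) : OnePoint ℂ)) :=
      (OnePoint.continuous_coe.continuousAt.comp (continuousAt_inv₀ hu0)).mono_left
        nhdsWithin_le_nhds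
    filter_upwards [hcont.eventually (h3 ((u⁻¹ : ℂ) : OnePoint ℂ) ∞ _ (hpU _) hu1 hu2),
      hcont.eventually ((hUo ((u⁻¹ : ℂ) : OnePoint ℂ)).mem_nhds (hpU _)),
      self_mem_nhdsWithin] with v hv hvU hvT
    obtain ⟨hv1, hv2, hv0⟩ := hT v hvT
    simp only [g]
    rw [← hv, hs' u⁻¹ v⁻¹ v⁻¹ hvU (hpU _) hv2, ← mul_assoc, mul_comm (c _ ∞ _),
      h2 _ _ _ _ hvU (hpU _) hv1 hv2]
  obtain ⟨u₀, hu₀, hu₀'⟩ := (hTfin.countable.dense_compl ℝ).inter_open_nonempty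
    (Metric.ball 0 (δ ∞)) Metric.isOpen_ball ⟨0, Metric.mem_ball_self (hδ ∞)⟩
  have hinf : ∀ (a : ℂ) w, w ∈ U a → w ∈ U ∞ → w ∉ B → g u₀ = c a ∞ w * s a := by
    intro a w hwa hw hwB
    obtain ⟨u, hu, rfl⟩ : w ∈ sphereChart ∞ '' Metric.ball 0 (δ ∞) := by rwa [← hU]
    have hu0 : u ≠ 0 := by
      rintro rfl
      rw [sphereChart_zero, hU] at hwa
      obtain ⟨v, -, hv⟩ := hwa
      exact OnePoint.coe_ne_infty _ hv
    have huT : u ∈ T := ⟨hu, by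
      rintro (h | h)
      · exact hu0 h
      · exact hwB h⟩
    rw [sphereChart_infty, sphereInv_coe hu0] at *
    rw [hgconst u₀ ⟨hu₀, hu₀'⟩ u huT]
    simp only [g]
    rw [hs' a u⁻¹ u⁻¹ hwa (hpU _) hwB, ← mul_assoc, mul_comm (c _ ∞ _),
      h2 _ _ _ _ hwa (hpU _) hw hwB]
  refine ⟨fun p => p.elim (g u₀) s, fun p q w hp hq hw => ?_⟩
  induction p using OnePoint.rec with
  | infty =>
    induction q using OnePoint.rec with
    | infty => rw [h1 _ _ hp hw, one_mul]
    | coe a =>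
      simp only [OnePoint.elim_some, OnePoint.elim_infty]
      rw [hinf a w hq hp hw, ← mul_assoc, h2 _ _ _ _ hp hq hp hw, h1 _ _ hp hw, one_mul]
  | coe a =>
    induction q using OnePoint.rec with
    | infty => exact hinf a w hp hq hw
    | coe b =>
      induction w using OnePoint.rec with
      | infty =>
        rw [hU] at hp
        obtain ⟨v, -, hv⟩ := hp
        exact absurd hv (OnePoint.coe_ne_infty _)
      | coe x => exact hs' a b x hp hq hw

/-! ### Orientations of the fibres -/

/-- The product of a function of pairs over all pairs of entries of a tuple, the entry of smaller
index first. -/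
def pairProd {X : Type*} (a : X → X → ℤ) {d : ℕ} (E : Fin d → X) : ℤ :=
  ∏ j, ∏ i ∈ Finset.Iio j, a (E i) (E j)

lemma pairProd_comp_perm {X : Type*} {a : X → X → ℤ} (ha : ∀ x y, a x y = -a y x) {d : ℕ}
    (E : Fin d → X) (σ : Equiv.Perm (Fin d)) :
    pairProd a (E ∘ σ) = Equiv.Perm.sign σ * pairProd a E :=
  σ.prod_Iio_comp_eq_sign_mul_prod (f := fun i j => a (E i) (E j)) fun _ _ => ha _ _

lemma pairProd_sq {X : Type*} {a : X → X → ℤ} {d : ℕ} {E : Fin d → X}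
    (h : ∀ i j, i ≠ j → a (E i) (E j) ^ 2 = 1) : pairProd a E ^ 2 = 1 := by
  unfold pairProd
  rw [← Finset.prod_pow]
  refine Finset.prod_eq_one fun j _ => ?_
  rw [← Finset.prod_pow]
  exact Finset.prod_eq_one fun i hi => h i j (Finset.mem_Iio.1 hi).ne

lemma eventually_pairProd_eq {X : Type*} [TopologicalSpace X] {a : X → X → ℤ} {d : ℕ}
    {E : Fin d → X} (h : ∀ i j, i ≠ j → ∀ᶠ q in 𝓝 (E i, E j), a q.1 q.2 = a (E i) (E j)) :
    ∀ᶠ E' in 𝓝 E, pairProd a E' = pairProd a E := by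
  have h' : ∀ i j : Fin d, ∀ᶠ E' : Fin d → X in 𝓝 E,
      i ≠ j → a (E' i) (E' j) = a (E i) (E j) := by
    intro i j
    by_cases hij : i = j
    · exact Eventually.of_forall fun _ h => absurd hij h
    · have hc : ContinuousAt (fun E' : Fin d → X => (E' i, E' j)) E := by fun_prop
      filter_upwards [hc.eventually (h i j hij)] with E' hE' _ using hE'
  filter_upwards [eventually_all.2 fun i => eventually_all.2 (h' i)] with E' hE'
  exact Finset.prod_congr rfl fun j _ => Finset.prod_congr rfl fun i hi =>
    hE' i j (Finset.mem_Iio.1 hi).ne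

/-- The tuple `E` enumerates the fibre of `F` over `w`, without repetition. -/
def IsEnumeration {X : Type*} (F : X → OnePoint ℂ) (w : OnePoint ℂ) {d : ℕ} (E : Fin d → X) :
    Prop :=
  Function.Injective E ∧ Set.range E = F ⁻¹' {w}

namespace IsEnumeration

variable {X : Type*} {F : X → OnePoint ℂ} {w : OnePoint ℂ} {d : ℕ} {E : Fin d → X}

lemma map_eq (hE : IsEnumeration F w E) (i : Fin d) : F (E i) = w := by
  have : E i ∈ F ⁻¹' {w} := hE.2 ▸ Set.mem_range_self i
  exact this

lemma exists_eq (hE : IsEnumeration F w E) {x : X} (hx : F x = w) : ∃ i, E i = x := by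
  have : x ∈ Set.range E := by
    rw [hE.2]
    exact hx
  exact this

lemma comp_iff (hE : IsEnumeration F w E) {d' : ℕ} (κ : Fin d' → Fin d) :
    IsEnumeration F w (E ∘ κ) ↔ Function.Bijective κ := by
  constructor
  · intro h
    refine ⟨h.1.of_comp, fun j => ?_⟩
    obtain ⟨i, hi⟩ := h.exists_eq (hE.map_eq j)
    exact ⟨i, hE.1 hi⟩
  · intro h
    exact ⟨hE.1.comp h.1, by rw [h.2.range_comp, hE.2]⟩

/-- Two enumerations of a fibre differ by a permutation. -/
lemma exists_perm (hE : IsEnumeration F w E) {d' : ℕ} {E' : Fin d' → X}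
    (hE' : IsEnumeration F w E') :
    ∃ (h : d' = d) (σ : Equiv.Perm (Fin d)), E' = E ∘ σ ∘ Fin.cast h := by
  choose κ hκ using fun i => hE.exists_eq (hE'.map_eq i)
  have hκ' : E ∘ κ = E' := funext hκ
  have hb : Function.Bijective κ := (hE.comp_iff κ).1 (hκ' ▸ hE')
  have hd : d' = d := by simpa using Fintype.card_of_bijective hb
  subst hd
  exact ⟨rfl, Equiv.ofBijective κ hb, hκ'.symm⟩

end IsEnumeration

section EvenlyCovered

variable {X : Type*} [TopologicalSpace X] {F : X → OnePoint ℂ}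

/-- An enumeration of an evenly covered fibre extends continuously to the nearby fibres. -/
lemma IsEnumeration.exists_extension {w₀ : OnePoint ℂ} {I : Type*} [TopologicalSpace I]
    (hcov : IsEvenlyCovered F w₀ I) {d : ℕ} {E : Fin d → X} (hE : IsEnumeration F w₀ E) :
    ∃ S : OnePoint ℂ → Fin d → X, S w₀ = E ∧ ContinuousAt S w₀ ∧
      ∀ᶠ w in 𝓝 w₀, IsEnumeration F w (S w) := by
  classical
  obtain ⟨-, U, hwU, hU, -, H, hH⟩ := hcov
  have hEU : ∀ i, E i ∈ F ⁻¹' U := fun i => by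
    rw [Set.mem_preimage, hE.map_eq i]
    exact hwU
  let k : Fin d → I := fun i => (H ⟨E i, hEU i⟩).2
  let S : OnePoint ℂ → Fin d → X := fun w i =>
    if h : w ∈ U then (H.symm (⟨w, h⟩, k i) : X) else E i
  have hk : ∀ i, H ⟨E i, hEU i⟩ = (⟨w₀, hwU⟩, k i) := fun i =>
    Prod.ext (Subtype.ext ((hH _).trans (hE.map_eq i))) rfl
  refine ⟨S, ?_, ?_, ?_⟩
  · funext i
    simp only [S, dif_pos hwU]
    rw [← hk i, H.symm_apply_apply]
  · have hcont : ContinuousOn S U := by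
      rw [continuousOn_iff_continuous_domRestrict]
      have : U.domRestrict S = fun w i => (H.symm (w, k i) : X) := by
        funext w i
        simp [S, w.2]
      rw [this]
      fun_prop
    exact hcont.continuousAt (hU.mem_nhds hwU)
  · filter_upwards [hU.mem_nhds hwU] with w hw
    have hS : ∀ i, S w i = (H.symm (⟨w, hw⟩, k i) : X) := fun i => by simp only [S, dif_pos hw]
    constructor
    · intro i j hij
      rw [hS, hS] at hij
      have h1 := congrArg Prod.snd (H.symm.injective (Subtype.ext hij))
      have h2 : H ⟨E i, hEU i⟩ = H ⟨E j, hEU j⟩ := by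
        rw [hk, hk]
        exact Prod.ext rfl h1
      exact hE.1 (congrArg Subtype.val (H.injective h2))
    · ext y
      constructor
      · rintro ⟨i, rfl⟩
        rw [hS]
        have := hH (H.symm (⟨w, hw⟩, k i))
        rw [H.apply_symm_apply] at this
        exact this.symm
      · intro hy
        have hyU : y ∈ F ⁻¹' U := by
          rw [Set.mem_preimage, show F y = w from hy]
          exact hw
        have hHy : H ⟨y, hyU⟩ = (⟨w, hw⟩, (H ⟨y, hyU⟩).2) :=
          Prod.ext (Subtype.ext ((hH _).trans hy)) rfl
        have h1 := hH (H.symm (⟨w₀, hwU⟩, (H ⟨y, hyU⟩).2))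
        rw [H.apply_symm_apply] at h1
        obtain ⟨i, hi⟩ := hE.exists_eq h1.symm
        refine ⟨i, ?_⟩
        have hki : k i = (H ⟨y, hyU⟩).2 := by
          have h2 : (⟨E i, hEU i⟩ : F ⁻¹' U) = H.symm (⟨w₀, hwU⟩, (H ⟨y, hyU⟩).2) :=
            Subtype.ext hi
          simp only [k]
          rw [h2, H.apply_symm_apply]
        rw [hS, hki, ← hHy, H.symm_apply_apply]

end EvenlyCovered

/-- The sign of an integer equal to `1` or `-1`, as a unit. -/
def unitSign (v : ℤ) : ℤˣ := if v = 1 then 1 else -1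

lemma coe_unitSign {v : ℤ} (hv : v ^ 2 = 1) : (unitSign v : ℤ) = v := by
  rcases sq_eq_one_iff.1 hv with h | h <;> simp [unitSign, h]

namespace IsBranchedCover

variable {X : Type*} [TopologicalSpace X] [CompactSpace X] {F : X → OnePoint ℂ} {e : X → ℕ}

lemma exists_enumeration (hF : IsBranchedCover F e) (w : OnePoint ℂ) :
    ∃ (d : ℕ) (E : Fin d → X), IsEnumeration F w E := by
  have : Finite (F ⁻¹' {w}) := hF.finite_fibre w
  obtain ⟨d, ⟨num⟩⟩ := Finite.exists_equiv_fin (F ⁻¹' {w})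
  refine ⟨d, fun i => num.symm i, fun i j h => num.symm.injective (Subtype.ext h), ?_⟩
  ext x
  constructor
  · rintro ⟨i, rfl⟩
    exact (num.symm i).2
  · intro hx
    exact ⟨num ⟨x, hx⟩, by simp⟩

variable [T2Space X]

/-- If all indices of a branched cover of the sphere are odd, the fibres over unbranched points
can be oriented consistently: there is a sign `o w E` of the enumerations `E` of the fibre over `w`
that is multiplied by the sign of a permutation when `E` is permuted, and is locally constant. -/
lemma exists_orientation (hF : IsBranchedCover F e) (hodd : ∀ x, Odd (e x))
    (hfin : {x | e x ≠ 1}.Finite) (d : ℕ) :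
    ∃ o : OnePoint ℂ → (Fin d → X) → ℤˣ,
      (∀ w E, IsEnumeration F w E → ∀ σ : Equiv.Perm (Fin d),
        o w (E ∘ σ) = Equiv.Perm.sign σ * o w E) ∧
      ∀ w₀ E₀, IsEnumeration F w₀ E₀ → (∀ x, F x = w₀ → e x = 1) →
        ∀ᶠ q : OnePoint ℂ × (Fin d → X) in 𝓝 (w₀, E₀),
          IsEnumeration F q.1 q.2 → (∀ x, F x = q.1 → e x = 1) → o q.1 q.2 = o w₀ E₀ := by
  -- the disc `U p` around `p` carries the orientation `pairProd (a p)`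
  choose δ hδ a ha hpair using fun p => hF.exists_pairSign p fun x _ => hodd x
  let U : OnePoint ℂ → Set (OnePoint ℂ) := fun p => sphereChart p '' Metric.ball 0 (δ p)
  have hUo : ∀ p, IsOpen (U p) := fun p =>
    (isOpenEmbedding_sphereChart p).isOpenMap _ Metric.isOpen_ball
  have hpU : ∀ p, p ∈ U p := fun p => ⟨0, Metric.mem_ball_self (hδ p), sphereChart_zero p⟩
  let B : Set (OnePoint ℂ) := F '' {x | e x ≠ 1}
  have hBe : ∀ {w}, w ∉ B → ∀ x, F x = w → e x = 1 := by
    intro w hw x hx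
    by_contra hne
    exact hw ⟨x, hne, hx⟩
  have hBe' : ∀ {w}, (∀ x, F x = w → e x = 1) → w ∉ B := by
    rintro w hw ⟨x, hx, hxw⟩
    exact hx (hw x hxw)
  have hsq : ∀ {p w} {n : ℕ} {E : Fin n → X}, w ∈ U p → IsEnumeration F w E →
      pairProd (a p) E ^ 2 = 1 := by
    rintro p w n E ⟨u, hu, rfl⟩ hE
    exact pairProd_sq fun i j hij => (hpair p _ _ u (mem_ball_zero_iff.1 hu) (hE.map_eq i)
      (hE.map_eq j) (hE.1.ne hij)).1
  have hloc : ∀ {p w} {n : ℕ} {E : Fin n → X}, w ∈ U p → IsEnumeration F w E →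
      ∀ᶠ E' in 𝓝 E, pairProd (a p) E' = pairProd (a p) E := by
    rintro p w n E ⟨u, hu, rfl⟩ hE
    exact eventually_pairProd_eq fun i j hij => (hpair p _ _ u (mem_ball_zero_iff.1 hu)
      (hE.map_eq i) (hE.map_eq j) (hE.1.ne hij)).2
  have hperm : ∀ {p w} {n : ℕ} {E : Fin n → X}, w ∈ U p → IsEnumeration F w E →
      ∀ σ : Equiv.Perm (Fin n), unitSign (pairProd (a p) (E ∘ σ)) =
        Equiv.Perm.sign σ * unitSign (pairProd (a p) E) := by
    intro p w n E hw hE σ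
    have h : IsEnumeration F w (E ∘ σ) := (hE.comp_iff σ).2 σ.bijective
    apply Units.ext
    rw [coe_unitSign (hsq hw h), Units.val_mul, coe_unitSign (hsq hw hE), pairProd_comp_perm (ha p)]
  choose n enum henum using hF.exists_enumeration
  -- the comparison of the orientations coming from two discs, on the fibre over `w`
  let c : OnePoint ℂ → OnePoint ℂ → OnePoint ℂ → ℤˣ := fun p q w =>
    unitSign (pairProd (a p) (enum w)) * unitSign (pairProd (a q) (enum w))
  have hc : ∀ {p q w} {n : ℕ} {E : Fin n → X}, w ∈ U p → w ∈ U q → IsEnumeration F w E →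
      c p q w = unitSign (pairProd (a p) E) * unitSign (pairProd (a q) E) := by
    intro p q w m E hp hq hE
    obtain ⟨hm, σ, rfl⟩ := (henum w).exists_perm hE
    subst hm
    have h := fun (r : OnePoint ℂ) (hr : w ∈ U r) => hperm hr (henum w) σ
    change _ = unitSign (pairProd (a p) (enum w ∘ σ)) * unitSign (pairProd (a q) (enum w ∘ σ))
    rw [h p hp, h q hq, mul_mul_mul_comm, Int.units_mul_self, one_mul]
  have hcov : ∀ {w}, w ∉ B → IsEvenlyCovered F w (F ⁻¹' {w}) := fun {w} hw =>
    hF.isCoveringMapOn (s := {w}) (fun x hx => hBe hw x hx) w rfl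
  have hmid : ∀ x y z : ℤˣ, x * y * (y * z) = x * z := by
    intro x y z
    rw [mul_assoc, ← mul_assoc y, Int.units_mul_self, one_mul]
  obtain ⟨s, hs⟩ := exists_sphere_coboundary hδ (hfin.image F) (U := U) (fun _ => rfl) c
    (fun p w _ _ => Int.units_mul_self _)
    (fun p q r w _ _ _ _ => hmid _ _ _)
    (fun p q w hp hq hw => by
      obtain ⟨S, hS0, hScont, hSenum⟩ := (henum w).exists_extension (hcov hw)
      rw [ContinuousAt, hS0] at hScont
      filter_upwards [hSenum, hScont.eventually (hloc hp (henum w)),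
        hScont.eventually (hloc hq (henum w)), (hUo p).mem_nhds hp, (hUo q).mem_nhds hq]
        with w' h1 h2 h3 h4 h5
      rw [hc h4 h5 h1, h2, h3])
  refine ⟨fun w E => s w * unitSign (pairProd (a w) E), fun w E hE σ => ?_,
    fun w₀ E₀ hE₀ hw₀ => ?_⟩
  · simp only
    rw [hperm (hpU w) hE, mul_left_comm]
  · have h1 : ∀ᶠ q : OnePoint ℂ × (Fin d → X) in 𝓝 (w₀, E₀), q.1 ∈ U w₀ :=
      continuousAt_fst.eventually ((hUo w₀).mem_nhds (hpU w₀))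
    have h2 : ∀ᶠ q : OnePoint ℂ × (Fin d → X) in 𝓝 (w₀, E₀),
        pairProd (a w₀) q.2 = pairProd (a w₀) E₀ :=
      continuousAt_snd.eventually (hloc (hpU w₀) hE₀)
    filter_upwards [h1, h2] with ⟨w, E⟩ hw hE hen hun
    simp only at hw hE hen hun ⊢
    rw [hs w₀ w w hw (hpU w) (hBe' hun), hc hw (hpU w) hen, ← hE, mul_right_comm,
      mul_assoc _ _ (unitSign _), Int.units_mul_self, mul_one, mul_comm]

/-- Lifts of a path that avoids the branch points and enumerate the fibre over its start enumerate
the fibre over each of its points. -/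
lemma isEnumeration_lift (hF : IsBranchedCover F e) {γ : C(unitInterval, OnePoint ℂ)}
    (hγ : ∀ t x, F x = γ t → e x = 1) {d : ℕ} {Γ : Fin d → C(unitInterval, X)}
    (hΓ : ∀ i t, F (Γ i t) = γ t) (h0 : IsEnumeration F (γ 0) fun i => Γ i 0) (t : unitInterval) :
    IsEnumeration F (γ t) fun i => Γ i t := by
  -- near `t₀` the lifts are among the sheets `S` over a neighbourhood, chosen by a map `κ` that does
  -- not depend on `t`, and they enumerate the fibre if and only if `κ` is bijective
  have key : ∀ t₀, ∀ᶠ t in 𝓝 t₀, (IsEnumeration F (γ t) fun i => Γ i t) =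
      IsEnumeration F (γ t₀) fun i => Γ i t₀ := by
    intro t₀
    obtain ⟨n, E, hE⟩ := hF.exists_enumeration (γ t₀)
    have hcov : IsEvenlyCovered F (γ t₀) (F ⁻¹' {γ t₀}) :=
      hF.isCoveringMapOn (s := {γ t₀}) (fun x hx => hγ t₀ x hx) _ rfl
    obtain ⟨S, hS0, hScont, hSenum⟩ := hE.exists_extension hcov
    choose κ hκ using fun i => hE.exists_eq (hΓ i t₀)
    have hinj : ∀ i, ∀ᶠ t in 𝓝 t₀, S (γ t) (κ i) = Γ i t := by
      intro i
      obtain ⟨-, Φ, hxΦ, -, hΦ⟩ := hF (E (κ i))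
      have hone : e (E (κ i)) = 1 := hγ t₀ _ (hE.map_eq _)
      have h1 : Tendsto (fun t => S (γ t) (κ i)) (𝓝 t₀) (𝓝 (E (κ i))) := by
        have h2 : Tendsto (fun t => S (γ t)) (𝓝 t₀) (𝓝 (S (γ t₀))) :=
          ContinuousAt.comp (f := γ) hScont γ.continuous.continuousAt
        rw [hS0] at h2
        exact (tendsto_pi_nhds.1 h2) (κ i)
      have h2 : Tendsto (Γ i) (𝓝 t₀) (𝓝 (E (κ i))) := by
        rw [hκ i]
        exact (Γ i).continuous.continuousAt
      filter_upwards [h1.eventually (Φ.open_source.mem_nhds hxΦ),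
        h2.eventually (Φ.open_source.mem_nhds hxΦ),
        γ.continuous.continuousAt.eventually hSenum] with t ht1 ht2 ht3
      refine Φ.injOn ht1 ht2 ?_
      have h3 : F (S (γ t) (κ i)) = F (Γ i t) := by rw [ht3.map_eq, hΓ]
      rw [hΦ _ ht1, hΦ _ ht2, hone, pow_one, pow_one] at h3
      exact sphereChart_injective _ h3
    filter_upwards [eventually_all.2 hinj, γ.continuous.continuousAt.eventually hSenum]
      with t ht hen
    have e1 : (fun i => Γ i t) = S (γ t) ∘ κ := funext fun i => (ht i).symm
    have e2 : (fun i => Γ i t₀) = E ∘ κ := funext fun i => (hκ i).symm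
    rw [e1, e2, hen.comp_iff, hE.comp_iff]
  have hloc : IsLocallyConstant fun t => IsEnumeration F (γ t) fun i => Γ i t :=
    (IsLocallyConstant.iff_eventually_eq _).2 key
  have := hloc.apply_eq_of_preconnectedSpace 0 t
  exact this.mp h0

/-- If all indices of a branched cover of the sphere are odd, its monodromy is even. -/
lemma sign_monodromy (hF : IsBranchedCover F e) (hodd : ∀ x, Odd (e x))
    (hfin : {x | e x ≠ 1}.Finite) {γ : C(unitInterval, OnePoint ℂ)} (hloop : γ 1 = γ 0)
    (hγ : ∀ t x, F x = γ t → e x = 1) {d : ℕ} {Γ : Fin d → C(unitInterval, X)}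
    (hΓ : ∀ i t, F (Γ i t) = γ t) (h0 : IsEnumeration F (γ 0) fun i => Γ i 0)
    {σ : Equiv.Perm (Fin d)} (hσ : ∀ i, Γ i 1 = Γ (σ i) 0) : Equiv.Perm.sign σ = 1 := by
  obtain ⟨o, ho1, ho2⟩ := hF.exists_orientation hodd hfin d
  have hen := hF.isEnumeration_lift hγ hΓ h0
  have hloc : IsLocallyConstant fun t => o (γ t) fun i => Γ i t := by
    refine (IsLocallyConstant.iff_eventually_eq _).2 fun t₀ => ?_
    have hcont : Continuous fun t => (γ t, fun i => Γ i t) := by fun_prop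
    filter_upwards [hcont.continuousAt.eventually (ho2 _ _ (hen t₀) (hγ t₀))] with t ht
    exact ht (hen t) (hγ t)
  have h := hloc.apply_eq_of_preconnectedSpace 1 0
  have h1 : (fun i => Γ i 1) = (fun i => Γ i 0) ∘ σ := funext hσ
  rw [hloop, h1, ho1 _ _ h0] at h
  simpa using h

end IsBranchedCover

/-! ### Local form of a meromorphic function -/

lemma eventually_codiscrete_iff {P : ℂ → Prop} :
    (∀ᶠ z in codiscrete ℂ, P z) ↔ ∀ z, ∀ᶠ w in 𝓝[≠] z, P w := by
  refine mem_codiscrete.trans (forall_congr' fun z => ?_)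
  rw [disjoint_principal_right, compl_compl]
  rfl

lemma limUnder_eq_of_analyticAt {f k : ℂ → ℂ} {z : ℂ} (hk : AnalyticAt ℂ k z)
    (hfk : f =ᶠ[𝓝[≠] z] k) : limUnder (𝓝[≠] z) f = k z :=
  Tendsto.limUnder_eq ((hk.continuousAt.tendsto.mono_left nhdsWithin_le_nhds).congr' hfk.symm)

lemma pointValue_eq_of_analyticAt {f k : ℂ → ℂ} {z : ℂ} (hk : AnalyticAt ℂ k z)
    (hfk : f =ᶠ[𝓝[≠] z] k) : pointValue f z = k z := by
  have h : ¬ meromorphicOrderAt f z < 0 := by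
    rw [meromorphicOrderAt_congr hfk, not_lt]
    exact hk.meromorphicOrderAt_nonneg
  rw [pointValue, if_neg h, limUnder_eq_of_analyticAt hk hfk]

lemma pointValue_eq_infty_iff {f : ℂ → ℂ} {z : ℂ} :
    pointValue f z = ∞ ↔ meromorphicOrderAt f z < 0 := by
  unfold pointValue
  split_ifs with h <;> simp [h]

/-- Around every point a non-constant meromorphic function, read in the coordinate of the sphere
centred at its value, is an analytic function whose order of vanishing is the ramification index. -/
lemma exists_analytic_local_form {f : ℂ → ℂ} {z : ℂ} (hf : MeromorphicAt f z)
    (hnc : ∀ c : ℂ, meromorphicOrderAt (fun w => f w - c) z ≠ ⊤) :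
    ∃ g : ℂ → ℂ, AnalyticAt ℂ g z ∧ g z = 0 ∧ 0 < pointIndex f z ∧
      meromorphicOrderAt g z = (pointIndex f z : ℤ) ∧
      ∀ᶠ w in 𝓝 z, pointValue f w = sphereChart (pointValue f z) (g w) := by
  have hf0 : meromorphicOrderAt f z ≠ ⊤ := by simpa using hnc 0
  by_cases hpole : meromorphicOrderAt f z < 0
  · have hidx : pointIndex f z = -(meromorphicOrderAt f z).untop₀ := by rw [pointIndex, if_pos hpole]
    have hval : pointValue f z = ∞ := pointValue_eq_infty_iff.2 hpole
    lift meromorphicOrderAt f z to ℤ using hf0 with n hn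
    have hn0 : n < 0 := by exact_mod_cast hpole
    have hord : meromorphicOrderAt f⁻¹ z = ((-n : ℤ) : WithTop ℤ) := by
      rw [meromorphicOrderAt_inv, ← hn]
      rfl
    obtain ⟨k, hk, hfk⟩ := hf.inv.meromorphicOrderAt_nonneg_iff.1 (by
      rw [hord]; exact_mod_cast (neg_pos.2 hn0).le)
    have hkord : meromorphicOrderAt k z = ((-n : ℤ) : WithTop ℤ) := by
      rw [← meromorphicOrderAt_congr hfk, hord]
    have hk0 : k z = 0 := by
      have h1 : Tendsto k (𝓝[≠] z) (𝓝 0) := tendsto_zero_of_meromorphicOrderAt_pos (by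
        rw [hkord]; exact_mod_cast neg_pos.2 hn0)
      exact tendsto_nhds_unique (hk.continuousAt.tendsto.mono_left nhdsWithin_le_nhds) h1
    have hne : ∀ᶠ w in 𝓝[≠] z, k w ≠ 0 :=
      (meromorphicOrderAt_ne_top_iff_eventually_ne_zero hk.meromorphicAt).1 (by simp [hkord])
    simp only [WithTop.untop₀_coe] at hidx
    refine ⟨k, hk, hk0, by omega, by rw [hkord, hidx], ?_⟩
    rw [hval, ← nhdsNE_sup_pure z, eventually_sup]
    refine ⟨?_, ?_⟩
    · filter_upwards [hne, eventually_eventually_nhdsWithin.2 hfk,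
        hk.eventually_analyticAt.filter_mono nhdsWithin_le_nhds, self_mem_nhdsWithin]
        with w hw1 hw2 hw3 hw4
      rw [sphereChart_infty, sphereInv_coe hw1]
      refine pointValue_eq_of_analyticAt (k := fun v => (k v)⁻¹) (hw3.inv hw1) ?_
      have h2 : ∀ᶠ v in 𝓝 w, f⁻¹ v = k v := by
        have := eventually_nhdsWithin_iff.1 hw2
        filter_upwards [this, isOpen_compl_singleton.mem_nhds hw4] with v hv hv'
        exact hv hv'
      filter_upwards [h2.filter_mono nhdsWithin_le_nhds] with v hv
      rw [← hv, Pi.inv_apply, inv_inv]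
    · simp [hk0, hval]
  · have hidx : pointIndex f z =
        (meromorphicOrderAt (fun w => f w - limUnder (𝓝[≠] z) f) z).untop₀ := by
      rw [pointIndex, if_neg hpole]
    obtain ⟨k, hk, hfk⟩ := hf.meromorphicOrderAt_nonneg_iff.1 (not_lt.1 hpole)
    have hval : pointValue f z = k z := pointValue_eq_of_analyticAt hk hfk
    rw [limUnder_eq_of_analyticAt hk hfk] at hidx
    have hg : AnalyticAt ℂ (fun w => k w - k z) z := hk.sub analyticAt_const
    have hgord : meromorphicOrderAt (fun w => k w - k z) z = (pointIndex f z : ℤ) := by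
      rw [hidx, WithTop.coe_untop₀_of_ne_top (hnc _)]
      refine meromorphicOrderAt_congr ?_
      filter_upwards [hfk] with w hw using by rw [hw]
    have hpos : 0 < pointIndex f z := by
      have h1 : 0 < meromorphicOrderAt (fun w => k w - k z) z := by
        refine (tendsto_zero_iff_meromorphicOrderAt_pos hg.meromorphicAt).1 ?_
        have := hg.continuousAt.tendsto.mono_left (nhdsWithin_le_nhds (s := {z}ᶜ))
        simpa using this
      rw [hgord] at h1
      exact_mod_cast h1
    refine ⟨_, hg, sub_self _, hpos, hgord, ?_⟩
    rw [hval, ← nhdsNE_sup_pure z, eventually_sup]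
    refine ⟨?_, by simp [hval]⟩
    filter_upwards [eventually_eventually_nhdsWithin.2 hfk,
      hk.eventually_analyticAt.filter_mono nhdsWithin_le_nhds, self_mem_nhdsWithin]
      with w hw2 hw3 hw4
    rw [sphereChart_coe, add_sub_cancel]
    refine pointValue_eq_of_analyticAt hw3 ?_
    have h2 : ∀ᶠ v in 𝓝 w, f v = k v := by
      have := eventually_nhdsWithin_iff.1 hw2
      filter_upwards [this, isOpen_compl_singleton.mem_nhds hw4] with v hv hv'
      exact hv hv'
    exact h2.filter_mono nhdsWithin_le_nhds

/-- An analytic function with a zero of order `n ≥ 1` is the `n`-th power of a local coordinate. -/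
lemma exists_eq_pow {g : ℂ → ℂ} {z : ℂ} {n : ℕ} (hn : n ≠ 0) (hg0 : g z = 0)
    (hg : AnalyticAt ℂ g z) (hord : meromorphicOrderAt g z = (n : ℤ)) :
    ∃ ψ : ℂ → ℂ, AnalyticAt ℂ ψ z ∧ ψ z = 0 ∧ deriv ψ z ≠ 0 ∧ ∀ᶠ w in 𝓝 z, g w = ψ w ^ n := by
  obtain ⟨h, hh, hh0, hgh⟩ := (meromorphicOrderAt_eq_int_iff hg.meromorphicAt).1 hord
  obtain ⟨a, ha⟩ := IsAlgClosed.exists_pow_nat_eq (h z) (Nat.pos_of_ne_zero hn)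
  have ha0 : a ≠ 0 := by
    rintro rfl
    rw [zero_pow hn] at ha
    exact hh0 ha.symm
  let ρ : ℂ → ℂ := fun w => a * Complex.exp (Complex.log (h w / h z) / n)
  have hquot : AnalyticAt ℂ (fun w => h w / h z) z := hh.div analyticAt_const hh0
  have hρ : AnalyticAt ℂ ρ z := by
    refine analyticAt_const.mul (AnalyticAt.cexp ?_)
    refine (hquot.clog ?_).div analyticAt_const (by exact_mod_cast hn)
    rw [div_self hh0]
    exact Complex.one_mem_slitPlane
  have hρz : ρ z = a := by simp [ρ, div_self hh0]
  have hρn : ∀ w, h w ≠ 0 → ρ w ^ n = h w := by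
    intro w hw
    have hn' : (n : ℂ) ≠ 0 := by exact_mod_cast hn
    simp only [ρ]
    rw [mul_pow, ha, ← Complex.exp_nat_mul, mul_div_cancel₀ _ hn',
      Complex.exp_log (div_ne_zero hw hh0), mul_div_cancel₀ _ hh0]
  have hψ : AnalyticAt ℂ (fun w => (w - z) * ρ w) z :=
    (analyticAt_id.sub analyticAt_const).mul hρ
  refine ⟨fun w => (w - z) * ρ w, hψ, by simp, ?_, ?_⟩
  · have h1 : HasDerivAt (fun w => (w - z) * ρ w) (1 * ρ z + (z - z) * deriv ρ z) z :=
      ((hasDerivAt_id z).sub_const z).mul hρ.differentiableAt.hasDerivAt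
    rw [h1.deriv, hρz]
    simpa using ha0
  · rw [← nhdsNE_sup_pure z, eventually_sup]
    refine ⟨?_, by simp [hg0, hn]⟩
    filter_upwards [hgh, (hh.continuousAt.eventually_ne hh0).filter_mono nhdsWithin_le_nhds]
      with w hw hw0
    rw [hw, mul_pow, hρn w hw0, zpow_natCast, smul_eq_mul]

/-- The order of the derivative: `e - 1` at a point of index `e` that is not a pole, and
`-e - 1 = (e - 1) - 2 e` at a pole of order `e`. -/
lemma meromorphicOrderAt_deriv_eq {f : ℂ → ℂ} {z : ℂ}
    (hnc : ∀ c : ℂ, meromorphicOrderAt (fun w => f w - c) z ≠ ⊤) (hpos : 0 < pointIndex f z) :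
    (pointValue f z = ∞ →
      meromorphicOrderAt (deriv f) z = ((pointIndex f z - 1 - 2 * pointIndex f z : ℤ))) ∧
    (pointValue f z ≠ ∞ → meromorphicOrderAt (deriv f) z = ((pointIndex f z - 1 : ℤ))) := by
  rw [ne_eq, pointValue_eq_infty_iff]
  constructor
  · intro hpole
    have hf0 : meromorphicOrderAt f z ≠ ⊤ := by simpa using hnc 0
    have hidx : pointIndex f z = -(meromorphicOrderAt f z).untop₀ := by rw [pointIndex, if_pos hpole]
    have h1 : meromorphicOrderAt f z = ((-pointIndex f z : ℤ) : WithTop ℤ) := by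
      rw [hidx, neg_neg, WithTop.coe_untop₀_of_ne_top hf0]
    rw [meromorphicOrderAt_deriv_eq_sub_one (by exact_mod_cast (neg_ne_zero.2 hpos.ne')) h1]
    congr 1
    ring
  · intro hpole
    have hidx : pointIndex f z =
        (meromorphicOrderAt (fun w => f w - limUnder (𝓝[≠] z) f) z).untop₀ := by
      rw [pointIndex, if_neg hpole]
    have h1 : meromorphicOrderAt (fun w => f w - limUnder (𝓝[≠] z) f) z =
        (pointIndex f z : WithTop ℤ) := by
      rw [hidx, WithTop.coe_untop₀_of_ne_top (hnc _)]
    have h2 := meromorphicOrderAt_deriv_eq_sub_one (by exact_mod_cast hpos.ne') h1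
    rwa [deriv_sub_const_fun] at h2

variable {L : PeriodPair}

/-! ### The elliptic curve as a compact Hausdorff space -/

instance : T2Space (EllipticCurve L) := by
  have : IsClosed (L.lattice.toAddSubgroup : Set ℂ) := L.isClosed_lattice
  infer_instance

lemma isLocalHomeomorph_mk :
    IsLocalHomeomorph (QuotientAddGroup.mk : ℂ → EllipticCurve L) := by
  have hd : DiscreteTopology L.lattice := inferInstance
  exact (AddSubgroup.isAddQuotientCoveringMap_of_comm L.lattice.toAddSubgroup
    ⟨hd⟩).isCoveringMap.isLocalHomeomorph

instance : CompactSpace (EllipticCurve L) := by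
  let φ : ℝ × ℝ → EllipticCurve L := fun q => ((q.1 * L.ω₁ + q.2 * L.ω₂ : ℂ) : EllipticCurve L)
  have hφ : Continuous φ := QuotientAddGroup.continuous_mk.comp (by fun_prop)
  have himage : φ '' (Set.Icc 0 1 ×ˢ Set.Icc 0 1) = Set.univ := by
    refine Set.eq_univ_of_forall fun x => ?_
    induction x using QuotientAddGroup.induction_on with
    | H z =>
      have hz : (L.basis.repr z 0 : ℂ) * L.ω₁ + (L.basis.repr z 1 : ℂ) * L.ω₂ = z := by
        have := L.basis.sum_repr z
        simpa [Fin.sum_univ_two] using this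
      refine ⟨(Int.fract (L.basis.repr z 0), Int.fract (L.basis.repr z 1)),
        ⟨⟨Int.fract_nonneg _, (Int.fract_lt_one _).le⟩,
          ⟨Int.fract_nonneg _, (Int.fract_lt_one _).le⟩⟩, ?_⟩
      refine QuotientAddGroup.eq.2 ?_
      change _ ∈ L.lattice
      rw [PeriodPair.mem_lattice]
      refine ⟨⌊L.basis.repr z 0⌋, ⌊L.basis.repr z 1⌋, ?_⟩
      have h0 : ((Int.fract (L.basis.repr z 0) : ℝ) : ℂ) =
          (L.basis.repr z 0 : ℂ) - (⌊L.basis.repr z 0⌋ : ℂ) := by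
        rw [Int.fract]; push_cast; rfl
      have h1 : ((Int.fract (L.basis.repr z 1) : ℝ) : ℂ) =
          (L.basis.repr z 1 : ℂ) - (⌊L.basis.repr z 1⌋ : ℂ) := by
        rw [Int.fract]; push_cast; rfl
      simp only [h0, h1]
      linear_combination hz
  refine ⟨?_⟩
  rw [← himage]
  exact (isCompact_Icc.prod isCompact_Icc).image hφ

/-! ### Meromorphic functions on the elliptic curve -/

namespace MeromorphicFunction

lemma ord_mk (f : MeromorphicFunction L) (z : ℂ) :
    f.ord (z : EllipticCurve L) = meromorphicOrderAt f z := rfl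

lemma toSphere_mk (f : MeromorphicFunction L) (z : ℂ) :
    f.toSphere (z : EllipticCurve L) = pointValue f z := rfl

lemma ramificationIndex_mk (f : MeromorphicFunction L) (z : ℂ) :
    f.ramificationIndex (z : EllipticCurve L) = pointIndex f z := rfl

/-- A constant function. -/
def const (L : PeriodPair) (c : ℂ) : MeromorphicFunction L where
  toFun := fun _ => c
  meromorphic' := fun z => MeromorphicAt.const c z
  periodic' := fun _ _ _ => rfl

/-- The derivative `df / dz`. -/
def derivative (f : MeromorphicFunction L) : MeromorphicFunction L where
  toFun := deriv f
  meromorphic' := fun z => (f.meromorphic' z).deriv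
  periodic' := fun l hl z => by
    have h : (fun w => f (w + l)) = f := funext (f.periodic' l hl)
    have := deriv_comp_add_const (f := f.toFun) l z
    rw [h] at this
    exact this.symm

lemma order_sub_const_ne_top {f : MeromorphicFunction L} (hf : ¬ f.IsConstant) (z c : ℂ) :
    meromorphicOrderAt (fun w => f w - c) z ≠ ⊤ := by
  intro htop
  refine hf ⟨c, eventually_codiscrete_iff.2 fun w => ?_⟩
  have hm : Meromorphic (fun w => f w - c) := fun w => (f.meromorphic' w).sub (.const c w)
  have hw : meromorphicOrderAt (fun w => f w - c) w = ⊤ := by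
    by_contra hne
    exact hm.meromorphicOn.meromorphicOrderAt_ne_top_of_isPreconnected isPreconnected_univ
      (Set.mem_univ w) (Set.mem_univ z) hne htop
  filter_upwards [meromorphicOrderAt_eq_top_iff.1 hw] with v hv using sub_eq_zero.1 hv

lemma ramificationIndex_pos {f : MeromorphicFunction L} (hf : ¬ f.IsConstant)
    (x : EllipticCurve L) : 0 < f.ramificationIndex x := by
  induction x using QuotientAddGroup.induction_on with
  | H z =>
    obtain ⟨g, -, -, hpos, -⟩ :=
      exists_analytic_local_form (f.meromorphic' z) (order_sub_const_ne_top hf z)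
    exact hpos

lemma ord_derivative {f : MeromorphicFunction L} (hf : ¬ f.IsConstant) (x : EllipticCurve L) :
    (f.toSphere x = ∞ → f.derivative.ord x =
      ((f.ramificationIndex x - 1 - 2 * f.ramificationIndex x : ℤ))) ∧
    (f.toSphere x ≠ ∞ → f.derivative.ord x = ((f.ramificationIndex x - 1 : ℤ))) := by
  have hpos := ramificationIndex_pos hf x
  induction x using QuotientAddGroup.induction_on with
  | H z => exact meromorphicOrderAt_deriv_eq (order_sub_const_ne_top hf z) hpos

lemma ord_derivative_ne_top {f : MeromorphicFunction L} (hf : ¬ f.IsConstant)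
    (x : EllipticCurve L) : f.derivative.ord x ≠ ⊤ := by
  by_cases h : f.toSphere x = ∞
  · rw [(ord_derivative hf x).1 h]
    exact WithTop.coe_ne_top
  · rw [(ord_derivative hf x).2 h]
    exact WithTop.coe_ne_top

lemma finite_ord_ne_zero (f : MeromorphicFunction L) (hf : ∀ x, f.ord x ≠ ⊤) :
    {x | f.ord x ≠ 0}.Finite := by
  have key : ∀ x : EllipticCurve L, ∃ N ∈ 𝓝 x, N ∩ {x | f.ord x ≠ 0} ⊆ {x} := by
    intro x
    induction x using QuotientAddGroup.induction_on with
    | H z =>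
      have h1 : ∀ᶠ w in 𝓝[≠] z, meromorphicOrderAt f w = 0 := by
        filter_upwards [(f.meromorphic' z).eventually_analyticAt,
          (meromorphicOrderAt_ne_top_iff_eventually_ne_zero (f.meromorphic' z)).1 (hf z)]
          with w hw hw0
        refine (tendsto_ne_zero_iff_meromorphicOrderAt_eq_zero hw.meromorphicAt).1 ⟨f w, hw0, ?_⟩
        exact hw.continuousAt.tendsto.mono_left nhdsWithin_le_nhds
      have h2 := eventually_nhdsWithin_iff.1 h1
      refine ⟨QuotientAddGroup.mk '' {w | w ∈ ({z}ᶜ : Set ℂ) → meromorphicOrderAt f w = 0},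
        isLocalHomeomorph_mk.isOpenMap.image_mem_nhds h2, ?_⟩
      rintro - ⟨⟨w, hw, rfl⟩, hw'⟩
      by_cases hwz : w = z
      · rw [hwz]; rfl
      · exact absurd (hw hwz) hw'
  choose N hN hsub using key
  obtain ⟨t, -, ht⟩ := isCompact_univ.elim_nhds_subcover N fun x _ => hN x
  refine t.finite_toSet.subset fun x hx => ?_
  obtain ⟨y, hy, hxy⟩ := Set.mem_iUnion₂.1 (ht (Set.mem_univ x))
  have : x = y := hsub y ⟨hxy, hx⟩
  rwa [this]

/-- A meromorphic function that is not identically zero has a divisor. -/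
lemma exists_divisor (f : MeromorphicFunction L) (hf : ∀ x, f.ord x ≠ ⊤) :
    ∃ D : Divisor L, IsDivisorOf f D := by
  have hfin : (Function.support fun x => (f.ord x).untop₀).Finite := by
    refine (f.finite_ord_ne_zero hf).subset fun x hx h0 => hx ?_
    simp [h0]
  refine ⟨Finsupp.ofSupportFinite _ hfin, fun x => ?_⟩
  exact (WithTop.coe_untop₀_of_ne_top (hf x)).symm

/-- A meromorphic function on `E` without zeros and poles is constant, by Liouville's theorem. -/
lemma eventually_eq_const (f : MeromorphicFunction L) (hf : ∀ x, f.ord x = 0) :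
    ∃ c : ℂ, f =ᶠ[codiscrete ℂ] fun _ => c := by
  let K : ℂ → ℂ := fun z => limUnder (𝓝[≠] z) f
  have hloc : ∀ z, ∃ k : ℂ → ℂ, AnalyticAt ℂ k z ∧ f =ᶠ[𝓝[≠] z] k ∧ K =ᶠ[𝓝 z] k := by
    intro z
    obtain ⟨k, hk, hfk⟩ := (f.meromorphic' z).meromorphicOrderAt_nonneg_iff.1 (hf z).ge
    refine ⟨k, hk, hfk, ?_⟩
    change ∀ᶠ w in 𝓝 z, K w = k w
    rw [← nhdsNE_sup_pure z, eventually_sup]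
    refine ⟨?_, limUnder_eq_of_analyticAt hk hfk⟩
    filter_upwards [eventually_eventually_nhdsWithin.2 hfk,
      hk.eventually_analyticAt.filter_mono nhdsWithin_le_nhds, self_mem_nhdsWithin]
      with w hw2 hw3 hw4
    refine limUnder_eq_of_analyticAt hw3 ?_
    have h2 : ∀ᶠ v in 𝓝 w, f v = k v := by
      filter_upwards [eventually_nhdsWithin_iff.1 hw2, isOpen_compl_singleton.mem_nhds hw4]
        with v hv hv'
      exact hv hv'
    exact h2.filter_mono nhdsWithin_le_nhds
  have hK : ∀ z, AnalyticAt ℂ K z := fun z => by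
    obtain ⟨k, hk, -, hKk⟩ := hloc z
    exact hk.congr hKk.symm
  have hdiff : Differentiable ℂ K := fun z => (hK z).differentiableAt
  let K' : EllipticCurve L → ℂ := descend K fun l hl z => limUnder_add f l z (f.periodic' l hl)
  have hK' : Continuous K' := by
    refine isLocalHomeomorph_mk.isOpenMap.isQuotientMap QuotientAddGroup.continuous_mk
      QuotientAddGroup.mk_surjective |>.continuous_iff.2 ?_
    exact hdiff.continuous
  have hbdd : Bornology.IsBounded (Set.range K) := by
    refine (isCompact_range hK').isBounded.subset ?_
    rintro - ⟨z, rfl⟩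
    exact ⟨(z : EllipticCurve L), rfl⟩
  refine ⟨K 0, eventually_codiscrete_iff.2 fun z => ?_⟩
  obtain ⟨k, hk, hfk, hKk⟩ := hloc z
  filter_upwards [hfk, hKk.filter_mono nhdsWithin_le_nhds] with w h1 h2
  rw [h1, ← h2]
  exact hdiff.apply_eq_apply_of_bounded hbdd w 0

/-- A non-constant meromorphic function on `E` is a branched cover of the sphere. -/
lemma isBranchedCover {f : MeromorphicFunction L} (hf : ¬ f.IsConstant) :
    IsBranchedCover f.toSphere fun x => (f.ramificationIndex x).toNat := by
  intro x
  have hpos := ramificationIndex_pos hf x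
  refine ⟨by simpa using hpos, ?_⟩
  induction x using QuotientAddGroup.induction_on with
  | H z =>
    obtain ⟨g, hg, hg0, -, hgord, hgval⟩ :=
      exists_analytic_local_form (f.meromorphic' z) (order_sub_const_ne_top hf z)
    beta_reduce
    rw [ramificationIndex_mk] at hpos ⊢
    set n := (pointIndex f z).toNat with hn
    have hn0 : n ≠ 0 := by omega
    have hnz : pointIndex f z = (n : ℤ) := by omega
    rw [hnz] at hgord
    obtain ⟨ψ, hψ, hψ0, hψd, hψn⟩ := exists_eq_pow hn0 hg0 hg hgord
    let R : OpenPartialHomeomorph ℂ ℂ :=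
      (hψ.hasStrictDerivAt.hasStrictFDerivAt_equiv hψd).toOpenPartialHomeomorph ψ
    have hzR : z ∈ R.source := HasStrictFDerivAt.mem_toOpenPartialHomeomorph_source _
    have hR : ∀ w, R w = ψ w := fun w => rfl
    obtain ⟨W, hW, hWo, hzW⟩ := eventually_nhds_iff.1 (hgval.and hψn)
    obtain ⟨S, hzS, hS⟩ := isLocalHomeomorph_mk (L := L) z
    have hSsymm : S.symm (z : EllipticCurve L) = z := by
      have := S.left_inv hzS
      rwa [← hS] at this
    refine ⟨S.symm.trans (R.restrOpen W hWo), ?_, ?_, ?_⟩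
    · rw [OpenPartialHomeomorph.trans_source]
      refine ⟨?_, ?_⟩
      · have := S.map_source hzS
        rwa [← hS] at this
      · rw [Set.mem_preimage, hSsymm]
        exact ⟨hzR, hzW⟩
    · rw [OpenPartialHomeomorph.trans_apply, hSsymm]
      exact hψ0
    · intro y hy
      rw [OpenPartialHomeomorph.trans_source] at hy
      have hyS : ((S.symm y : ℂ) : EllipticCurve L) = y := by
        have := S.right_inv hy.1
        rwa [← hS] at this
      have hyW := hW _ hy.2.2
      rw [OpenPartialHomeomorph.trans_apply]
      change _ = sphereChart _ (ψ (S.symm y) ^ n)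
      rw [← hyW.2, toSphere_mk, ← hyW.1, ← toSphere_mk, hyS]

end MeromorphicFunction

/-! ### Odd ramification and odd covers -/

namespace MeromorphicFunction

/-- A non-constant function is an odd cover as soon as all its ramification indices are odd: no
further condition is needed for its monodromy to be even. -/
lemma isOddCover_of_odd {f : MeromorphicFunction L} (hf : ¬ f.IsConstant)
    (hodd : ∀ x, Odd (f.ramificationIndex x)) (hfin : {x | f.ramificationIndex x ≠ 1}.Finite) :
    f.IsOddCover := by
  have hF := isBranchedCover hf
  have hpos := ramificationIndex_pos hf
  have hodd' : ∀ x, Odd (f.ramificationIndex x).toNat := fun x => by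
    have h := hodd x
    rw [← Int.toNat_of_nonneg (hpos x).le] at h
    exact_mod_cast h
  have hone : ∀ x, (f.ramificationIndex x).toNat = 1 ↔ f.ramificationIndex x = 1 := fun x => by
    have := hpos x
    omega
  have hfin' : {x | (f.ramificationIndex x).toNat ≠ 1}.Finite := by
    simpa only [ne_eq, hone] using hfin
  refine ⟨hf, fun q hq => ?_, fun p _ => ?_⟩
  · have : Finite (f.Fibre q) := hF.finite_fibre q
    obtain ⟨d, ⟨num⟩⟩ := Finite.exists_equiv_fin (f.Fibre q)
    refine ⟨d, num, ?_⟩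
    rintro τ ⟨γ, hγ, hτ⟩
    choose Γ hΓ0 hΓ1 hΓ using hτ
    rw [Equiv.Perm.mem_alternatingGroup]
    refine hF.sign_monodromy hodd' hfin' (γ := γ.toContinuousMap) ?_ ?_
      (Γ := fun i => Γ (num.symm i)) (fun i t => hΓ _ t) ?_ ?_
    · change γ 1 = γ 0
      rw [γ.source, γ.target]
    · intro t x hx
      rw [hone]
      by_contra hne
      exact hγ t ⟨x, hx, hne⟩
    · change IsEnumeration _ (γ 0) _
      rw [γ.source]
      simp only [hΓ0]
      refine ⟨Subtype.val_injective.comp num.symm.injective, ?_⟩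
      ext x
      constructor
      · rintro ⟨i, rfl⟩
        exact (num.symm i).2
      · intro hx
        exact ⟨num ⟨x, hx⟩, by simp⟩
    · intro i
      rw [hΓ1, hΓ0]
      simp [Equiv.permCongr_apply]
  · obtain ⟨δ, hδ, h⟩ := hF.exists_rotation p fun x _ => hodd' x
    refine ⟨δ, hδ, fun r hr hrδ => ?_⟩
    have h0 : circleAround p r 0 = sphereChart p r := by
      rw [circleAround_eq_sphereChart p hr]
      simp
    obtain ⟨τ, hτ, hτodd⟩ := h r hr hrδ
    rw [h0]
    refine ⟨τ, fun x => ?_, hτodd⟩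
    obtain ⟨Γ, hΓ0, hΓ1, hΓ⟩ := hτ x
    exact ⟨Γ, hΓ0, hΓ1, fun t => by rw [hΓ, circleAround_eq_sphereChart p hr]⟩

/-- A spin structure makes the cover odd: the ramification indices are `1 + 2 D x`. -/
lemma HasSpinStructure.isOddCover {f : MeromorphicFunction L} (hf : ¬ f.IsConstant) {ϑ : Pic L}
    (h : f.HasSpinStructure ϑ) : f.IsOddCover := by
  obtain ⟨D, -, hD, -, -⟩ := h
  have hD' : ∀ x, f.ramificationIndex x = 2 * D x + 1 := fun x => by
    have := hD x
    rw [Finsupp.smul_apply, nsmul_eq_mul] at this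
    push_cast at this
    omega
  refine isOddCover_of_odd hf (fun x => ⟨D x, hD' x⟩) ?_
  refine D.hasFiniteSupport.subset fun x hx => ?_
  rw [Function.mem_support]
  rintro h0
  exact hx (by rw [hD', h0]; rfl)

/-! ### Spin structures and the differential equation -/

/-- The pullback divisor of `∞`, i.e. the divisor of poles. -/
lemma exists_pullbackDivisor {f : MeromorphicFunction L} (hf : ¬ f.IsConstant) :
    ∃ A : Divisor L, f.IsPullbackDivisor ∞ A := by
  classical
  have hfin : (Function.support fun x =>
      if f.toSphere x = ∞ then f.ramificationIndex x else 0).Finite := by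
    refine (f.finite_ord_ne_zero fun x => ?_).subset fun x hx h0 => hx ?_
    · induction x using QuotientAddGroup.induction_on with
      | H z => simpa [ord_mk] using order_sub_const_ne_top hf z 0
    · refine if_neg fun hpole => ?_
      induction x using QuotientAddGroup.induction_on with
      | H z =>
        have h1 := pointValue_eq_infty_iff.1 hpole
        rw [ord_mk] at h0
        rw [h0] at h1
        exact lt_irrefl _ h1
  exact ⟨Finsupp.ofSupportFinite _ hfin, fun x => ⟨fun h => if_pos h, fun h => if_neg h⟩⟩

/-- The divisor of `df / dz` is `R_f - 2 f^*(∞)`. -/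
lemma ord_derivative_eq {f : MeromorphicFunction L} (hf : ¬ f.IsConstant) {A : Divisor L}
    (hA : f.IsPullbackDivisor ∞ A) (x : EllipticCurve L) :
    f.derivative.ord x = ((f.ramificationIndex x - 1 - 2 * A x : ℤ) : WithTop ℤ) := by
  by_cases h : f.toSphere x = ∞
  · rw [(ord_derivative hf x).1 h, (hA x).1 h]
  · rw [(ord_derivative hf x).2 h, (hA x).2 h, mul_zero, sub_zero]

end MeromorphicFunction

lemma IsDivisorOf.mul {f g : MeromorphicFunction L} {D D' : Divisor L} (hf : IsDivisorOf f D)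
    (hg : IsDivisorOf g D') : IsDivisorOf (f.mul g) (D + D') := fun x => by
  rw [MeromorphicFunction.ord_mul, hf x, hg x, Finsupp.add_apply]
  rfl

lemma IsDivisorOf.inv {f : MeromorphicFunction L} {D : Divisor L} (hf : IsDivisorOf f D) :
    IsDivisorOf f.inv (-D) := fun x => by
  rw [MeromorphicFunction.ord_inv, hf x, Finsupp.neg_apply]
  rfl

lemma lineBundle_eq_iff {D D' : Divisor L} :
    lineBundle D = lineBundle D' ↔ ∃ g : MeromorphicFunction L, IsDivisorOf g (-D + D') :=
  QuotientAddGroup.eq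

lemma lineBundle_sub (D D' : Divisor L) :
    lineBundle (D - D') = lineBundle D - lineBundle D' := rfl

open MeromorphicFunction in
/-- Two meromorphic functions with the same divisor are proportional. -/
lemma IsDivisorOf.eventually_eq_const_mul {f g : MeromorphicFunction L} {D : Divisor L}
    (hf : IsDivisorOf f D) (hg : IsDivisorOf g D) :
    ∃ c : ℂ, f =ᶠ[codiscrete ℂ] fun z => c * g z := by
  obtain ⟨c, hc⟩ := (f.mul g.inv).eventually_eq_const fun x => by
    rw [(hf.mul hg.inv) x, add_neg_cancel]
    rfl
  refine ⟨c, eventually_codiscrete_iff.2 fun z => ?_⟩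
  have hg0 : ∀ᶠ w in 𝓝[≠] z, g w ≠ 0 := by
    refine (meromorphicOrderAt_ne_top_iff_eventually_ne_zero (g.meromorphic' z)).1 ?_
    have := hg (z : EllipticCurve L)
    rw [ord_mk] at this
    rw [this]
    exact WithTop.coe_ne_top
  filter_upwards [hg0, eventually_codiscrete_iff.1 hc z] with w hw hcw
  rw [← hcw]
  change f w = f w * (g w)⁻¹ * g w
  rw [inv_mul_cancel_right₀ hw]

open MeromorphicFunction in
/-- If `div u = 2 T`, then `f` has the spin structure `𝒪_E(T)` if and only if `df = s² u dz` can be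
solved: both say that `div (df / dz) = R_f - 2 f^*(∞)` is of the form `2 div s + 2 T`. -/
lemma hasSpinStructure_iff {f : MeromorphicFunction L} (hf : ¬ f.IsConstant)
    {u : MeromorphicFunction L} {T : Divisor L} (hu : IsDivisorOf u (2 • T)) :
    f.HasSpinStructure (lineBundle T) ↔ ∃ s : MeromorphicFunction L, SolvesEquation f s u := by
  constructor
  · rintro ⟨D, A, hD, hA, hT⟩
    rw [← lineBundle_sub, lineBundle_eq_iff] at hT
    obtain ⟨g, hg⟩ := hT
    have h1 : IsDivisorOf f.derivative (2 • D - 2 • A) := fun x => by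
      rw [ord_derivative_eq hf hA x, ← hD x]
      simp
    have h2 : IsDivisorOf ((g.mul g).mul u) (2 • D - 2 • A) := by
      convert (hg.mul hg).mul hu using 1
      abel
    obtain ⟨c, hc⟩ := h1.eventually_eq_const_mul h2
    obtain ⟨r, hr⟩ := IsAlgClosed.exists_pow_nat_eq c two_pos
    refine ⟨(const L r).mul g, ?_⟩
    filter_upwards [hc] with z hz
    refine hz.trans ?_
    change c * (g z * g z * u z) = (r * g z) ^ 2 * u z
    rw [← hr]
    ring
  · rintro ⟨s, hs⟩
    have hord : ∀ x, f.derivative.ord x = s.ord x + s.ord x + u.ord x := by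
      intro x
      rw [← ord_mul, ← ord_mul]
      induction x using QuotientAddGroup.induction_on with
      | H z =>
        refine meromorphicOrderAt_congr ?_
        filter_upwards [eventually_codiscrete_iff.1 hs z] with w hw
        refine hw.trans ?_
        change s w ^ 2 * u w = s w * s w * u w
        ring
    have hs0 : ∀ x, s.ord x ≠ ⊤ := by
      intro x hx
      have := hord x
      rw [hx, top_add, top_add] at this
      exact ord_derivative_ne_top hf x this
    obtain ⟨S, hS⟩ := s.exists_divisor hs0
    obtain ⟨A, hA⟩ := exists_pullbackDivisor hf
    refine ⟨S + T + A, A, fun x => ?_, hA, ?_⟩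
    · have h1 := hord x
      rw [ord_derivative_eq hf hA x, hS x, hu x] at h1
      have h2 : f.ramificationIndex x - 1 - 2 * A x = S x + S x + (2 • T) x := by exact_mod_cast h1
      simp only [Finsupp.smul_apply, Finsupp.add_apply, nsmul_eq_mul] at h2 ⊢
      push_cast at h2 ⊢
      linarith
    · rw [← lineBundle_sub, lineBundle_eq_iff]
      refine ⟨s, ?_⟩
      convert hS using 1
      abel

end OddCover

end

open OddCover in
theorem proposition2p1 (L : PeriodPair) (ϑ : Pic L) (hϑ : ϑ ∈ picZero L) (hϑ2 : 2 • ϑ = 0)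
    (f : MeromorphicFunction L) (hf : ¬ f.IsConstant) :
    -- the case `ω = dz`
    (ϑ = lineBundle 0 →
      ((f.IsOddCover ∧ f.HasSpinStructure ϑ) ↔
        ∃ s : MeromorphicFunction L, SolvesEquation f s (MeromorphicFunction.one L))) ∧
    -- the case `ω = h dz`
    (∀ Q : EllipticCurve L, Q ≠ 0 → 2 • Q = 0 →
      ∀ h : MeromorphicFunction L, IsDivisorOf h (2 • point Q - 2 • point 0) →
      ϑ = lineBundle (point 0 - point Q) →
      ((f.IsOddCover ∧ f.HasSpinStructure ϑ) ↔
        ∃ s : MeromorphicFunction L, SolvesEquation f s h)) := by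
  refine ⟨?_, fun Q _ _ h hh => ?_⟩
  · rintro rfl
    rw [and_iff_right_of_imp fun hspin => hspin.isOddCover hf]
    refine hasSpinStructure_iff hf fun x => ?_
    rw [MeromorphicFunction.ord_one, smul_zero]
    rfl
  · rintro rfl
    rw [and_iff_right_of_imp fun hspin => hspin.isOddCover hf]
    -- `P - Q` and `Q - P` are linearly equivalent, as `div h = 2 Q - 2 P`
    have hT : lineBundle (point 0 - point Q) = lineBundle (point Q - point 0) := by
      rw [lineBundle_eq_iff]
      refine ⟨h, ?_⟩
      convert hh using 1
      abel
    rw [hT]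
    refine hasSpinStructure_iff hf ?_
    rwa [smul_sub]
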